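/- Let $\omega$ be a primitive element of $\mathbb F_9$. Then $x^8-1=\prod_{j=0}^{7}(x+\omega^j)=(x+1)(x-1)\prod_{j=1}^{3}(x+\omega^j)(x+\omega^{-j})$ in $\mathbb F_9[x]$. Identify a vector $c\in\mathbb F_9^{16}$ with the pair $(c_0(x),c_1(x))$, where $c_t(x)=\sum_{g=0}^{7}c_{2g+t}x^g$ (positions numbered $0,\dots,15$), regarded in $R^2$ with $R=\mathbb F_9[x]/\langle x^8-1\rangle$. A linear code of length 16 is quasi-cyclic of index 2 if 2 is the least positive integer $s$ such that the code is invariant under the cyclic shift by $s$ positions; its constituent at an 8th root of unity $a\in\mathbb F_9$ is $\{(c_0(a),c_1(a)) : c\in C\}\subseteq\mathbb F_9^2$. There is exactly one linear code $C\subseteq\mathbb F_9^{16}$ that is quasi-cyclic of index 2 and whose constituents at $-1,\,1,\,\omega^5,\,\omega^3,\,\omega^6,\,\omega^2,\,\omega^7,\,\omega$ are, respectively, $$\langle(1,\omega^2)\rangle,\quad 0,\quad \mathbb F_9^2,\quad 0,\quad 0,\quad \langle(1,\omega^7)\rangle,\quad \langle(1,\omega^6)\rangle,\quad 0 .$$ If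 $\omega^2=\omega+1$, then $C$ corresponds to the $R$-submodule of $R^2$ generated by $(f_{1,0},f_{1,1})$ and $(f_{2,0},f_{2,1})$, where $$\begin{aligned} f_{1,0}&=\omega^3x^7+\omega x^5+\omega^6x^3+\omega^2x-1,\\ f_{1,1}&=\omega^2x^7-x^6-x^4+\omega^3x^3+\omega^7x+\omega^3,\\ f_{2,0}&=0,\\ f_{2,1}&=\omega x^7+\omega^6x^6+\omega^3x^5+x^4+\omega^5x^3+\omega^2x^2+\omega^7x-1.\end{aligned}$$ Let $C^{\perp_H}$ denote the dual of $C$ with respect to the Hermitian form $\langle v,u\rangle=\sum_i v_iu_i^3$. Then $\dim C=5$ and $\dim(C\cap C^{\perp_H})=4$, so that $e:=\dim C-\dim(C\cap C^{\perp_H})=1$; the code $C^{\perp_H}$ is a $[16,11,5]_9$ code; and the minimum distance of $C+C^{\perp_H}$ is 4. There exists a $[\![17,7,5]\!]_3$ stabilizer code, and it is optimal: every $[\![17,7,d]\!]_3$ stabilizer code has $d\le 5$. There also exist stabilizer codes with parameters $[\![17,6,5]\!]_3$, $[\![18,7,5]\!]_3$ and $[\![16,7,4]\!]_3$. Here an $[\![n,k,d]\!]_3$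 stabilizer code ($k\ge1$) is a subspace $Q$ of dimension $3^k$ of $(\mathbb C^3)^{\otimes n}$ that is the joint eigenspace, with eigenvalue 1, of a group of operators $\zeta^cX(a)Z(b)$, where $\zeta=e^{2\pi i/3}$, $c\in\mathbb F_3$, $a,b\in\mathbb F_3^n$, $X(a)|x\rangle=|x+a\rangle$ and $Z(b)|x\rangle=\zeta^{b\cdot x}|x\rangle$, and whose minimum distance is exactly $d$: with $P$ the orthogonal projection onto $Q$, the operator $P\,X(a)Z(b)\,P$ is a scalar multiple of $P$ whenever fewer than $d$ indices $i$ have $(a_i,b_i)\ne(0,0)$, but not always when exactly $d$ do. -/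

import Mathlib

open Polynomial

/-! ### Linear codes over a finite field -/

section Classical

variable {F : Type*} [Field F]

/-- `d` is the minimum distance of the linear code `C`: the least weight of a nonzero codeword. -/
def IsMinDist [DecidableEq F] {n : ℕ} (C : Submodule F (Fin n → F)) (d : ℕ) : Prop :=
  IsLeast {w | ∃ c ∈ C, c ≠ 0 ∧ hammingNorm c = w} d

/-- `C` is an `[n, k, d]` linear code over `F`. -/
def IsLinearCode [DecidableEq F] (n k d : ℕ) (C : Submodule F (Fin n → F)) : Prop :=
  Module.finrank F C = k ∧ IsMinDist C d

/-- The Hermitian dual of `C`, for the form `⟨v, u⟩ = ∑ v_i * u_i ^ q`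
(to be used over a field with `q ^ 2` elements). -/
def hermitianDual (q : ℕ) {n : ℕ} (C : Submodule F (Fin n → F)) : Submodule F (Fin n → F) where
  carrier := {v | ∀ u ∈ C, ∑ i, v i * u i ^ q = 0}
  zero_mem' := by
    intro u _
    simp
  add_mem' := by
    intro v w hv hw u hu
    simp only [Pi.add_apply, add_mul, Finset.sum_add_distrib]
    rw [hv u hu, hw u hu, add_zero]
  smul_mem' := by
    intro a v hv u hu
    simp only [Pi.smul_apply, smul_eq_mul, mul_assoc]
    rw [← Finset.mul_sum, hv u hu, mul_zero]

/-- The cyclic shift by `s` positions: the entry in position `i` moves to position `i + s`. -/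
def cyclicShift {n : ℕ} (s : ℕ) (c : Fin n → F) : Fin n → F :=
  fun i => c (((finRotate n) ^ s).symm i)

/-- `C` is quasi-cyclic of index `l`: `l` is the least positive number such that `C` is invariant
under the cyclic shift by `l` positions. -/
def IsQuasiCyclic {n : ℕ} (l : ℕ) (C : Submodule F (Fin n → F)) : Prop :=
  IsLeast {s | 0 < s ∧ ∀ c ∈ C, cyclicShift s c ∈ C} l

/-- A vector of length `m * l` is read row by row as an `m × l` array; the entry in row `g` and
column `t` is the one in position `g * l + t`. -/
def arrayEntry {m l : ℕ} (c : Fin (m * l) → F) (g : Fin m) (t : Fin l) : F :=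
  c (finProdFinEquiv (g, t))

/-- The polynomial `c_t(x) = ∑_g c_{g,t} x^g` of the column `t` of the array. -/
noncomputable def columnPoly {m l : ℕ} (c : Fin (m * l) → F) (t : Fin l) : F[X] :=
  ∑ g : Fin m, C (arrayEntry c g t) * X ^ (g : ℕ)

/-- The identification of vectors of length `m * l` with elements of `R ^ l`, where
`R = F[x] / (x ^ m - 1)`. -/
noncomputable def toPolyVector {m l : ℕ} (c : Fin (m * l) → F) :
    Fin l → AdjoinRoot (X ^ m - 1 : F[X]) :=
  fun t => AdjoinRoot.mk (X ^ m - 1 : F[X]) (columnPoly c t)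

/-- Evaluation of `(c_0(x), …, c_{l-1}(x))` at an element `a` of `F`, as a linear map. -/
noncomputable def evalAt (m l : ℕ) (a : F) : (Fin (m * l) → F) →ₗ[F] (Fin l → F) where
  toFun c := fun t => (columnPoly c t).eval a
  map_add' := by
    intro c d
    funext t
    simp [columnPoly, arrayEntry, add_mul, Finset.sum_add_distrib]
  map_smul' := by
    intro r c
    funext t
    simp [columnPoly, arrayEntry, mul_assoc, Finset.mul_sum, eval_finsetSum]

/-- The constituent of `C` at a root `a` of `x ^ m - 1` lying in `F` (that is, belonging to the
linear factor `x - a`): the code of length `l` of all evaluations of codewords at `a`. -/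
noncomputable def constituent (m l : ℕ) (C : Submodule F (Fin (m * l) → F)) (a : F) :
    Submodule F (Fin l → F) :=
  C.map (evalAt m l a)

/-- `C` is a quasi-cyclic code of length `8 * 2` and index `2` with the prescribed constituents
at the roots of `x ^ 8 - 1`, where `ω` is a primitive element of the field with `9` elements. -/
def IsQutritExampleCode (ω : F) (C : Submodule F (Fin (8 * 2) → F)) : Prop :=
  IsQuasiCyclic 2 C ∧
  constituent 8 2 C (-1) = Submodule.span F {![1, ω ^ 2]} ∧
  constituent 8 2 C 1 = ⊥ ∧
  constituent 8 2 C (ω ^ 5) = ⊤ ∧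
  constituent 8 2 C (ω ^ 3) = ⊥ ∧
  constituent 8 2 C (ω ^ 6) = ⊥ ∧
  constituent 8 2 C (ω ^ 2) = Submodule.span F {![1, ω ^ 7]} ∧
  constituent 8 2 C (ω ^ 7) = Submodule.span F {![1, ω ^ 6]} ∧
  constituent 8 2 C ω = ⊥

/-- The generator `(f_{1,0}, f_{1,1})`. -/
noncomputable def qutritGen1 (ω : F) : Fin 2 → F[X] :=
  ![C (ω ^ 3) * X ^ 7 + C ω * X ^ 5 + C (ω ^ 6) * X ^ 3 + C (ω ^ 2) * X - 1,
    C (ω ^ 2) * X ^ 7 - X ^ 6 - X ^ 4 + C (ω ^ 3) * X ^ 3 + C (ω ^ 7) * X + C (ω ^ 3)]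

/-- The generator `(f_{2,0}, f_{2,1})`. -/
noncomputable def qutritGen2 (ω : F) : Fin 2 → F[X] :=
  ![0,
    C ω * X ^ 7 + C (ω ^ 6) * X ^ 6 + C (ω ^ 3) * X ^ 5 + X ^ 4 + C (ω ^ 5) * X ^ 3
      + C (ω ^ 2) * X ^ 2 + C (ω ^ 7) * X - 1]

/-- The image of a vector of polynomials in `R ^ l`, where `R = F[x] / (x ^ m - 1)`. -/
noncomputable def reducePolyVector (m : ℕ) {l : ℕ} (f : Fin l → F[X]) :
    Fin l → AdjoinRoot (X ^ m - 1 : F[X]) :=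
  fun t => AdjoinRoot.mk (X ^ m - 1 : F[X]) (f t)

end Classical

/-! ### Stabilizer codes on qudits of prime dimension `p` -/

section Quantum

/-- The `n`-fold tensor power of `ℂ ^ p`, through its orthonormal basis of product vectors
`|x⟩ = |x_1⟩ ⊗ ⋯ ⊗ |x_n⟩` with `x` in `(ℤ/p) ^ n`. -/
abbrev QuditSpace (p n : ℕ) [NeZero p] : Type := EuclideanSpace ℂ (Fin n → ZMod p)

/-- The error operator `X(a) Z(b)`, where `X(a)|x⟩ = |x + a⟩`, `Z(b)|x⟩ = ζ ^ (b · x) |x⟩` and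
`ζ = exp (2 π i / p)`. -/
noncomputable def errorOp {p n : ℕ} [NeZero p] (a b : Fin n → ZMod p) :
    QuditSpace p n →ₗ[ℂ] QuditSpace p n where
  toFun ψ := WithLp.toLp 2 fun x => ZMod.stdAddChar (∑ i, b i * (x i - a i)) * ψ (x - a)
  map_add' := by
    intro ψ φ
    ext x
    simp [mul_add]
  map_smul' := by
    intro r ψ
    ext x
    simp [mul_left_comm]

/-- The weight of the error `X(a) Z(b)`: the number of tensor factors on which it is not the
identity. -/
def errorWeight {p n : ℕ} (a b : Fin n → ZMod p) : ℕ :=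
  (Finset.univ.filter fun i => a i ≠ 0 ∨ b i ≠ 0).card

/-- `Q` is a stabilizer code: a nonzero subspace that is the joint eigenspace with eigenvalue `1`
of a group `S` of operators of the form `ζ ^ c X(a) Z(b)`. -/
def IsStabilizerSubspace {p n : ℕ} [NeZero p] (Q : Submodule ℂ (QuditSpace p n)) : Prop :=
  Q ≠ ⊥ ∧ ∃ S : Subgroup (QuditSpace p n ≃ₗ[ℂ] QuditSpace p n),
    (∀ g ∈ S, ∃ (c : ZMod p) (a b : Fin n → ZMod p),
      (g : QuditSpace p n →ₗ[ℂ] QuditSpace p n) = (ZMod.stdAddChar c : ℂ) • errorOp a b) ∧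
    ∀ ψ : QuditSpace p n, ψ ∈ Q ↔ ∀ g ∈ S, g ψ = ψ

/-- The code `Q` detects the error `E`: `P E P` is a scalar multiple of `P`, for the orthogonal
projection `P` onto `Q`. -/
def DetectsError {p n : ℕ} [NeZero p] (Q : Submodule ℂ (QuditSpace p n))
    (E : QuditSpace p n →ₗ[ℂ] QuditSpace p n) : Prop :=
  ∃ c : ℂ, ∀ ψ ∈ Q, ∀ φ ∈ Q, inner ℂ ψ (E φ) = c * inner ℂ ψ φ

/-- `d` is the minimum distance of the quantum code `Q` (of dimension greater than one): all errors
of weight less than `d` are detected, but not all errors of weight `d`. -/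
def IsQuantumMinDist {p n : ℕ} [NeZero p] (Q : Submodule ℂ (QuditSpace p n)) (d : ℕ) : Prop :=
  (∀ a b : Fin n → ZMod p, errorWeight a b < d → DetectsError Q (errorOp a b)) ∧
  ∃ a b : Fin n → ZMod p, errorWeight a b = d ∧ ¬ DetectsError Q (errorOp a b)

/-- `Q` is an `[[n, k, d]]_p` stabilizer code, for `p` prime and `k` positive. -/
def IsStabilizerCode (p n k d : ℕ) [NeZero p] (Q : Submodule ℂ (QuditSpace p n)) : Prop :=
  IsStabilizerSubspace Q ∧ Module.finrank ℂ Q = p ^ k ∧ IsQuantumMinDist Q d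

end Quantum

/-!
The quasi-cyclic code is studied through the discrete Fourier transform (`spectrum8`): as `ω` is a
primitive eighth root of unity, a code that is invariant under the shift by two positions is the set
of all words whose evaluations at the powers of `ω` lie in its constituents
(`eq_spectralCode_constituent`). Existence and uniqueness follow, and duals, intersections, sums and
dimensions are computed in `F ^ 2`, one frequency at a time (`hermitianDual_spectralCode`).
The only minimum distance argument is `le_hammingNorm`. In the dual code both columns vanish at `ω`,
so neither has weight one. If one of them is zero, the other one vanishes at `ω, ω ^ 2, ω ^ 3` (and
`ω ^ 4`), and the BCH bound applies. If both have weight two, the linear relations at `ω ^ 2` and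
`ω ^ 4` make `ω` a square in `F`, by the identity `x ^ 3 - y ^ 3 = (x - y) ^ 3`. Words of the
least weight are the generators `(x - ω) ⋯ (x - ω ^ m)` of cyclic codes.

Stabilizer codes are translated into isotropic subspaces of `(ℤ/p) ^ n × (ℤ/p) ^ n` in
`exists_isStabilizerCode_iff`. The dimension of the code, and the fact that an error which commutes
with the stabilizer without belonging to it is not detected, both come from the trace of the
projection onto the code: an error operator has trace zero unless it is a scalar (`trace_errorOp`).
For the field with nine elements, a Hermitian self-orthogonal code gives an isotropic subspace
(`exists_isSymplecticCode_of_hermitian`).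

The intersection of the code with its Hermitian dual gives a `[[16, 8, 4]]` code. Only the component
at `-1` prevents the code itself from being self-orthogonal, and one additional entry repairs this
(`extendedCode`). The dual of the extended code has minimum distance five because a word in it either
ends in zero, and then comes from the dual code, or has weight at least four in the first `16`
entries. The remaining parameters follow by the propagation rules
`IsSymplecticCode.exists_subcode` and `IsSymplecticCode.exists_lengthening`.

A `[[17, 7]]` code detecting all errors of weight five would meet the quantum Singleton bound.
Comparing the dimensions of the stabilizer on five positions and on their complement shows that its
stabilizer has no elements of weight at most `12` (`inf_supportedOn_eq_bot`), that is, it is an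
additive maximum distance separable code; counting its elements of weight `13` inside a set of `14`
positions gives a contradiction (`false_of_detects_five`).
-/

/-! ### Error operators -/

section ErrorOperators

variable {p n : ℕ}

/-- The group of labels `(a, b)` of the errors `X(a) Z(b)`. -/
abbrev PhaseSpace (p n : ℕ) : Type := (Fin n → ZMod p) × (Fin n → ZMod p)

/-- The symplectic form `((a, b), (a', b')) ↦ b · a' - b' · a`, which measures how far the errors
`X(a) Z(b)` and `X(a') Z(b')` are from commuting. -/
def symplecticForm (p n : ℕ) : LinearMap.BilinForm (ZMod p) (PhaseSpace p n) :=
  LinearMap.mk₂ (ZMod p) (fun u v => u.2 ⬝ᵥ v.1 - v.2 ⬝ᵥ u.1)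
    (by intro u u' v; simp only [Prod.snd_add, Prod.fst_add, add_dotProduct, dotProduct_add]; ring)
    (by intro c u v; simp only [Prod.smul_snd, Prod.smul_fst, smul_dotProduct, dotProduct_smul,
          smul_sub])
    (by intro u v v'; simp only [Prod.snd_add, Prod.fst_add, add_dotProduct, dotProduct_add]; ring)
    (by intro c u v; simp only [Prod.smul_snd, Prod.smul_fst, smul_dotProduct, dotProduct_smul,
          smul_sub])

theorem symplecticForm_apply (u v : PhaseSpace p n) :
    symplecticForm p n u v = u.2 ⬝ᵥ v.1 - v.2 ⬝ᵥ u.1 := rfl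

theorem symplecticForm_swap (u v : PhaseSpace p n) :
    symplecticForm p n u v = -symplecticForm p n v u := by
  simp only [symplecticForm_apply]; ring

theorem symplecticForm_isRefl : (symplecticForm p n).IsRefl := fun u v h => by
  rw [symplecticForm_swap, h, neg_zero]

theorem symplecticForm_single (u : PhaseSpace p n) (i : Fin n) :
    symplecticForm p n (0, Pi.single i 1) u = u.1 i ∧
      symplecticForm p n (Pi.single i 1, 0) u = -u.2 i := by
  simp [symplecticForm_apply]

theorem symplecticForm_nondegenerate : (symplecticForm p n).Nondegenerate := by
  have key : ∀ u : PhaseSpace p n, (∀ v, symplecticForm p n v u = 0) → u = 0 := by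
    intro u hu
    ext i
    · simpa [hu] using ((symplecticForm_single u i).1).symm
    · simpa [hu] using ((symplecticForm_single u i).2).symm
  refine ⟨fun u hu => key u fun v => ?_, fun u hu => key u hu⟩
  rw [symplecticForm_swap, hu, neg_zero]

variable [NeZero p]

theorem errorOp_apply (a b : Fin n → ZMod p) (ψ : QuditSpace p n) (x : Fin n → ZMod p) :
    errorOp a b ψ x = ZMod.stdAddChar (b ⬝ᵥ (x - a)) * ψ (x - a) := rfl

theorem errorOp_zero : errorOp (0 : Fin n → ZMod p) 0 = LinearMap.id := by
  ext ψ x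
  simp [errorOp_apply]

theorem errorOp_mul (u v : PhaseSpace p n) :
    errorOp u.1 u.2 * errorOp v.1 v.2 =
      (ZMod.stdAddChar (u.2 ⬝ᵥ v.1) : ℂ) • errorOp (u + v).1 (u + v).2 := by
  ext ψ x
  simp only [Module.End.mul_apply, LinearMap.smul_apply, PiLp.smul_apply, errorOp_apply,
    smul_eq_mul, ← mul_assoc, ← AddChar.map_add_eq_mul]
  rw [show x - (u + v).1 = x - u.1 - v.1 by rw [Prod.fst_add]; abel]
  congr 2
  simp only [Prod.snd_add, add_dotProduct, dotProduct_sub]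
  ring

/-- The commutation relation of error operators. -/
theorem errorOp_comm (u v : PhaseSpace p n) :
    errorOp u.1 u.2 * errorOp v.1 v.2 =
      (ZMod.stdAddChar (symplecticForm p n u v) : ℂ) • (errorOp v.1 v.2 * errorOp u.1 u.2) := by
  rw [errorOp_mul, errorOp_mul, smul_smul, ← AddChar.map_add_eq_mul, add_comm v u]
  congr 2
  rw [symplecticForm_apply]; ring_nf

theorem inner_errorOp (u : PhaseSpace p n) (ψ φ : QuditSpace p n) :
    inner ℂ (errorOp u.1 u.2 ψ) (errorOp u.1 u.2 φ) = inner ℂ ψ φ := by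
  simp only [PiLp.inner_apply, errorOp_apply]
  rw [← Equiv.sum_comp (Equiv.subRight u.1) (fun x => inner ℂ (ψ x) (φ x))]
  refine Finset.sum_congr rfl fun x _ => ?_
  simp only [RCLike.inner_apply, map_mul, Equiv.subRight_apply]
  rw [← AddChar.map_neg_eq_conj]
  have h : (ZMod.stdAddChar (u.2 ⬝ᵥ (x - u.1)) : ℂ) * ZMod.stdAddChar (-(u.2 ⬝ᵥ (x - u.1))) = 1 := by
    rw [← AddChar.map_add_eq_mul, add_neg_cancel, AddChar.map_zero_eq_one]
  linear_combination (φ (x - u.1) * (starRingEnd ℂ) (ψ (x - u.1))) * h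

theorem trace_errorOp (u : PhaseSpace p n) :
    LinearMap.trace ℂ (QuditSpace p n) (errorOp u.1 u.2) = if u = 0 then (p : ℂ) ^ n else 0 := by
  rw [LinearMap.trace_eq_sum_inner _ (EuclideanSpace.basisFun (Fin n → ZMod p) ℂ)]
  simp only [EuclideanSpace.basisFun_apply, EuclideanSpace.inner_single_left, map_one, one_mul,
    errorOp_apply]
  split_ifs with h
  · subst h
    simp [ZMod.card]
  · by_cases h1 : u.1 = 0
    · have h2 : u.2 ≠ 0 := fun h2 => h (Prod.ext h1 h2)
      obtain ⟨i, hi⟩ := Function.ne_iff.1 h2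
      let f : AddChar (Fin n → ZMod p) ℂ :=
        ZMod.stdAddChar.compAddMonoidHom ⟨⟨fun x => u.2 ⬝ᵥ x, dotProduct_zero _⟩, dotProduct_add _⟩
      have hf : f ≠ 1 := by
        intro hf
        have : f (Pi.single i 1) = 1 := by rw [hf]; rfl
        have h3 : (ZMod.stdAddChar (u.2 i) : ℂ) = ZMod.stdAddChar (0 : ZMod p) := by
          rw [AddChar.map_zero_eq_one, ← this]
          change _ = (ZMod.stdAddChar (u.2 ⬝ᵥ Pi.single i 1) : ℂ)
          simp
        exact hi (ZMod.injective_stdAddChar h3)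
      have := AddChar.sum_eq_zero_of_ne_one hf
      rw [← this]
      refine Finset.sum_congr rfl fun x _ => ?_
      simp only [h1, sub_zero, PiLp.single_apply, if_true, mul_one]
      rfl
    · refine Finset.sum_eq_zero fun x _ => ?_
      rw [PiLp.single_apply, if_neg, mul_zero]
      simpa using h1

theorem natCast_pow_ne_zero : (p : ℂ) ^ n ≠ 0 := pow_ne_zero _ (Nat.cast_ne_zero.2 (NeZero.ne p))

theorem stdAddChar_ne_zero (z : ZMod p) : (ZMod.stdAddChar z : ℂ) ≠ 0 := fun h0 => by
  have := AddChar.norm_apply (ZMod.stdAddChar (N := p)) z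
  rw [h0] at this; simp at this

/-- The label of an operator `ζ ^ c X(a) Z(b)` is determined by the operator. -/
theorem errorOp_label_unique {c c' : ZMod p} {u v : PhaseSpace p n}
    (h : (ZMod.stdAddChar c : ℂ) • errorOp u.1 u.2 = (ZMod.stdAddChar c' : ℂ) • errorOp v.1 v.2) :
    u = v := by
  by_contra huv
  have h2 := congrArg (fun f => LinearMap.trace ℂ _ (errorOp (-u).1 (-u).2 * f)) h
  simp only [mul_smul_comm, errorOp_mul, map_smul, trace_errorOp] at h2
  rw [if_pos (by abel), if_neg (by rwa [neg_add_eq_zero])] at h2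
  simp [stdAddChar_ne_zero, NeZero.ne p] at h2

theorem errorOp_injective (u : PhaseSpace p n) (ψ : QuditSpace p n)
    (h : errorOp u.1 u.2 ψ = 0) : ψ = 0 := by
  rw [← inner_self_eq_zero (𝕜 := ℂ), ← inner_errorOp u, h, inner_zero_left]

end ErrorOperators

/-! ### Stabilizer groups and their labels -/

section AverageTrace

variable {G V : Type*} [Group G] [Finite G] [AddCommGroup V] [Module ℂ V] [FiniteDimensional ℂ V]

/-- If `T` acts on the fixed space of a finite group as the scalar `c`, comparing the traces of `T`
and of the identity, both composed with the projection onto the fixed space, gives this identity. -/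
theorem sum_trace_mul_eq (ρ : Representation ℂ G V) (T : V →ₗ[ℂ] V) (c : ℂ)
    (hT : ∀ v ∈ ρ.invariants, T v = c • v) :
    ∑ᶠ g, LinearMap.trace ℂ V (T * ρ g) = c * (Nat.card G * Module.finrank ℂ ρ.invariants) := by
  classical
  have := Fintype.ofFinite G
  have hc : (Fintype.card G : ℂ) ≠ 0 := Nat.cast_ne_zero.2 Fintype.card_ne_zero
  let _ : Invertible (Fintype.card G : ℂ) := invertibleOfNonzero hc
  have h1 : T * ρ.averageMap = c • ρ.averageMap := by
    ext v
    exact hT _ (ρ.averageMap_invariant v)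
  have h2 : ρ.averageMap = (Fintype.card G : ℂ)⁻¹ • ∑ g, ρ g := by
    simp [Representation.averageMap, GroupAlgebra.average]
  have h3 := congrArg (LinearMap.trace ℂ V) h1
  rw [map_smul, ρ.isProj_averageMap.trace, h2, mul_smul_comm, map_smul, Finset.mul_sum, map_sum,
    smul_eq_mul, smul_eq_mul, inv_mul_eq_iff_eq_mul₀ hc] at h3
  rw [finsum_eq_sum_of_fintype, h3, Nat.card_eq_fintype_card]
  ring

end AverageTrace

section StabilizerGroups

variable {p n : ℕ} [NeZero p]

/-- All elements of the group `S` are of the form `ζ ^ c X(a) Z(b)`. -/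
def IsErrorGroup (S : Subgroup (QuditSpace p n ≃ₗ[ℂ] QuditSpace p n)) : Prop :=
  ∀ g ∈ S, ∃ (c : ZMod p) (a b : Fin n → ZMod p),
    (g : QuditSpace p n →ₗ[ℂ] QuditSpace p n) = (ZMod.stdAddChar c : ℂ) • errorOp a b

/-- The tautological representation of a group of operators. -/
def operatorRep (S : Subgroup (QuditSpace p n ≃ₗ[ℂ] QuditSpace p n)) :
    Representation ℂ S (QuditSpace p n) where
  toFun g := ((g : QuditSpace p n ≃ₗ[ℂ] QuditSpace p n) : QuditSpace p n →ₗ[ℂ] QuditSpace p n)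
  map_one' := rfl
  map_mul' _ _ := rfl

/-- The labels `(a, b)` of the elements `ζ ^ c X(a) Z(b)` of a group of error operators. -/
def errorLabels (S : Subgroup (QuditSpace p n ≃ₗ[ℂ] QuditSpace p n)) :
    Submodule (ZMod p) (PhaseSpace p n) where
  carrier := {u | ∃ g ∈ S, ∃ c : ZMod p,
    (g : QuditSpace p n →ₗ[ℂ] QuditSpace p n) = (ZMod.stdAddChar c : ℂ) • errorOp u.1 u.2}
  zero_mem' := ⟨1, S.one_mem, 0, by
    simp only [Prod.fst_zero, Prod.snd_zero, errorOp_zero, AddChar.map_zero_eq_one, one_smul]; rfl⟩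
  add_mem' := by
    rintro u v ⟨g, hg, c, hgc⟩ ⟨h, hh, d, hhd⟩
    refine ⟨g * h, S.mul_mem hg hh, c + d + u.2 ⬝ᵥ v.1, ?_⟩
    change (g : QuditSpace p n →ₗ[ℂ] QuditSpace p n) * (h : QuditSpace p n →ₗ[ℂ] QuditSpace p n) = _
    rw [hgc, hhd, smul_mul_smul_comm, errorOp_mul, smul_smul, AddChar.map_add_eq_mul,
      AddChar.map_add_eq_mul]
  smul_mem' := by
    rintro k u ⟨g, hg, c, hgc⟩
    rw [← ZMod.natCast_zmod_val k, Nat.cast_smul_eq_nsmul]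
    induction k.val with
    | zero => exact ⟨1, S.one_mem, 0, by
        simp only [zero_smul, Prod.fst_zero, Prod.snd_zero, errorOp_zero, AddChar.map_zero_eq_one,
          one_smul]; rfl⟩
    | succ m ih =>
      obtain ⟨h, hh, d, hhd⟩ := ih
      refine ⟨h * g, S.mul_mem hh hg, d + c + (m • u).2 ⬝ᵥ u.1, ?_⟩
      change (h : QuditSpace p n →ₗ[ℂ] QuditSpace p n) *
        (g : QuditSpace p n →ₗ[ℂ] QuditSpace p n) = _
      rw [hgc, hhd, smul_mul_smul_comm, errorOp_mul, smul_smul, AddChar.map_add_eq_mul,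
        AddChar.map_add_eq_mul, succ_nsmul]

variable {S : Subgroup (QuditSpace p n ≃ₗ[ℂ] QuditSpace p n)} {Q : Submodule ℂ (QuditSpace p n)}

theorem IsErrorGroup.finite (hS : IsErrorGroup S) : Finite S := by
  choose! c a b h using hS
  refine Finite.of_injective
    (fun g : S => (c g, a g, b g) : S → ZMod p × (Fin n → ZMod p) × (Fin n → ZMod p)) ?_
  intro g g' hgg
  simp only [Prod.mk.injEq] at hgg
  have := h g g.2
  rw [hgg.1, hgg.2.1, hgg.2.2, ← h g' g'.2] at this
  exact Subtype.ext (LinearEquiv.toLinearMap_injective this)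

theorem invariants_operatorRep (hQ : ∀ ψ, ψ ∈ Q ↔ ∀ g ∈ S, g ψ = ψ) :
    (operatorRep S).invariants = Q := by
  ext ψ
  rw [hQ, Representation.mem_invariants]
  exact ⟨fun h g hg => h ⟨g, hg⟩, fun h g => h g g.2⟩

/-- In the stabilizer of a nonzero vector, only the identity is a multiple of the identity. -/
theorem eq_one_of_label_eq_zero (hQ : ∀ ψ, ψ ∈ Q ↔ ∀ g ∈ S, g ψ = ψ) (hQ0 : Q ≠ ⊥)
    {g : QuditSpace p n ≃ₗ[ℂ] QuditSpace p n} (hg : g ∈ S) {z : ℂ}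
    (h : (g : QuditSpace p n →ₗ[ℂ] QuditSpace p n) = z • LinearMap.id) : g = 1 := by
  obtain ⟨ψ, hψ, hψ0⟩ := Q.ne_bot_iff.1 hQ0
  have h1 : z • ψ = ψ := by
    rw [← (hQ ψ).1 hψ g hg]
    conv_rhs => rw [← LinearEquiv.coe_coe, h]
    rw [(hQ ψ).1 hψ g hg]; rfl
  have hz : z = 1 := by
    have : (z - 1) • ψ = 0 := by rw [sub_smul, h1, one_smul, sub_self]
    simpa [hψ0, sub_eq_zero] using this
  apply LinearEquiv.toLinearMap_injective
  rw [h, hz, one_smul]; rfl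

theorem trace_eq_zero_of_ne_one (hS : IsErrorGroup S) (hQ : ∀ ψ, ψ ∈ Q ↔ ∀ g ∈ S, g ψ = ψ)
    (hQ0 : Q ≠ ⊥) {g : QuditSpace p n ≃ₗ[ℂ] QuditSpace p n} (hg : g ∈ S) (hg1 : g ≠ 1) :
    LinearMap.trace ℂ (QuditSpace p n) g = 0 := by
  obtain ⟨c, a, b, h⟩ := hS g hg
  rw [h, map_smul, trace_errorOp (a, b), if_neg, smul_zero]
  rintro h0
  obtain ⟨rfl, rfl⟩ := Prod.mk.inj h0
  rw [errorOp_zero] at h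
  exact hg1 (eq_one_of_label_eq_zero hQ hQ0 hg h)

/-- The dimension formula for the fixed space of a group of operators of trace zero. -/
theorem card_mul_finrank_of_trace [Finite S] (hQ : ∀ ψ, ψ ∈ Q ↔ ∀ g ∈ S, g ψ = ψ)
    (ht : ∀ g ∈ S, g ≠ 1 → LinearMap.trace ℂ (QuditSpace p n) g = 0) :
    Nat.card S * Module.finrank ℂ Q = p ^ n := by
  have h := sum_trace_mul_eq (operatorRep S) LinearMap.id 1 (fun v _ => (one_smul ℂ v).symm)
  rw [invariants_operatorRep hQ, one_mul, finsum_eq_single _ 1] at h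
  · have h1 := trace_errorOp (0 : PhaseSpace p n)
    rw [if_pos rfl, Prod.fst_zero, Prod.snd_zero, errorOp_zero] at h1
    rw [map_one] at h
    change LinearMap.trace ℂ (QuditSpace p n) LinearMap.id = _ at h
    rw [h1] at h
    exact_mod_cast h.symm
  · intro g hg
    exact ht g g.2 fun h => hg (Subtype.ext h)

theorem natCard_errorLabels (hS : IsErrorGroup S) (hQ : ∀ ψ, ψ ∈ Q ↔ ∀ g ∈ S, g ψ = ψ)
    (hQ0 : Q ≠ ⊥) : Nat.card (errorLabels S) = Nat.card S := by
  choose! c a b h using hS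
  refine (Nat.card_congr (Equiv.ofBijective
    (fun g : S => (⟨(a g, b g), g, g.2, c g, h g g.2⟩ : errorLabels S)) ⟨?_, ?_⟩)).symm
  · intro g g' hgg
    have h1 : a g = a g' := congrArg (fun u => u.1.1) hgg
    have h2 : b g = b g' := congrArg (fun u => u.1.2) hgg
    have h3 : g⁻¹ * g' = 1 := by
      apply Subtype.ext
      refine eq_one_of_label_eq_zero hQ hQ0 (g⁻¹ * g').2
        (z := ZMod.stdAddChar (c g') * (ZMod.stdAddChar (c g))⁻¹) ?_
      ext ψ : 1
      change (g : QuditSpace p n ≃ₗ[ℂ] QuditSpace p n)⁻¹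
        (((g' : QuditSpace p n ≃ₗ[ℂ] QuditSpace p n) : QuditSpace p n →ₗ[ℂ] QuditSpace p n) ψ) = _
      refine (LinearEquiv.symm_apply_eq _).2 ?_
      rw [h g' g'.2, ← LinearEquiv.coe_coe, h g g.2, ← h1, ← h2]
      simp only [LinearMap.smul_apply, LinearMap.id_apply, map_smul, smul_smul, mul_assoc]
      rw [inv_mul_cancel₀ (stdAddChar_ne_zero _), mul_one]
    exact inv_mul_eq_one.1 h3
  · rintro ⟨u, g, hg, d, hgd⟩
    refine ⟨⟨g, hg⟩, Subtype.ext ?_⟩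
    exact errorOp_label_unique (u := (a g, b g)) ((h g hg).symm.trans hgd)

/-- A stabilizer group of a nonzero vector is commutative, that is, its labels are symplectically
orthogonal to each other. -/
theorem errorLabels_le_orthogonal (hQ : ∀ ψ, ψ ∈ Q ↔ ∀ g ∈ S, g ψ = ψ) (hQ0 : Q ≠ ⊥) :
    errorLabels S ≤ (symplecticForm p n).orthogonal (errorLabels S) := by
  rintro v ⟨h, hh, d, hhd⟩
  rw [LinearMap.BilinForm.mem_orthogonal_iff]
  rintro u ⟨g, hg, c, hgc⟩
  obtain ⟨ψ, hψ, hψ0⟩ := Q.ne_bot_iff.1 hQ0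
  have e1 : (g : QuditSpace p n →ₗ[ℂ] QuditSpace p n) ((h : QuditSpace p n →ₗ[ℂ] QuditSpace p n) ψ)
      = ψ := by
    simp [(hQ ψ).1 hψ h hh, (hQ ψ).1 hψ g hg]
  have e2 : (h : QuditSpace p n →ₗ[ℂ] QuditSpace p n) ((g : QuditSpace p n →ₗ[ℂ] QuditSpace p n) ψ)
      = ψ := by
    simp [(hQ ψ).1 hψ h hh, (hQ ψ).1 hψ g hg]
  rw [← Module.End.mul_apply, hgc, hhd, smul_mul_smul_comm] at e1 e2
  rw [errorOp_comm, smul_comm, mul_comm (ZMod.stdAddChar c : ℂ), LinearMap.smul_apply, e2] at e1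
  have h2 : ((ZMod.stdAddChar (symplecticForm p n u v) : ℂ) - 1) • ψ = 0 := by
    rw [sub_smul, e1, one_smul, sub_self]
  have h3 : (ZMod.stdAddChar (symplecticForm p n u v) : ℂ) = ZMod.stdAddChar (0 : ZMod p) := by
    rw [AddChar.map_zero_eq_one]
    simpa [hψ0, sub_eq_zero] using h2
  exact ZMod.injective_stdAddChar h3

/-- An error is detected if and only if it is, up to phase, in the stabilizer, or fails to commute
with some element of the stabilizer. -/
theorem detectsError_iff (hS : IsErrorGroup S) (hQ : ∀ ψ, ψ ∈ Q ↔ ∀ g ∈ S, g ψ = ψ)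
    (hQ0 : Q ≠ ⊥) (v : PhaseSpace p n) :
    DetectsError Q (errorOp v.1 v.2) ↔
      v ∈ errorLabels S ∨ v ∉ (symplecticForm p n).orthogonal (errorLabels S) := by
  constructor
  · rintro ⟨c, hc⟩
    by_contra! hv
    obtain ⟨hv, hv'⟩ := hv
    rw [LinearMap.BilinForm.mem_orthogonal_iff] at hv'
    have hcomm : ∀ g ∈ S, (g : QuditSpace p n →ₗ[ℂ] QuditSpace p n) * errorOp v.1 v.2 =
        errorOp v.1 v.2 * (g : QuditSpace p n →ₗ[ℂ] QuditSpace p n) := by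
      intro g hg
      obtain ⟨d, a, b, h⟩ := hS g hg
      have h0 := hv' (a, b) ⟨g, hg, d, h⟩
      rw [h, smul_mul_assoc, mul_smul_comm, errorOp_comm (a, b) v, h0, AddChar.map_zero_eq_one,
        one_smul]
    have hact : ∀ ψ ∈ Q, errorOp v.1 v.2 ψ = c • ψ := by
      intro ψ hψ
      have hE : errorOp v.1 v.2 ψ ∈ Q := by
        rw [hQ]
        intro g hg
        have := congrArg (fun f => f ψ) (hcomm g hg)
        simpa [(hQ ψ).1 hψ g hg] using this
      have hd : errorOp v.1 v.2 ψ - c • ψ ∈ Q := Q.sub_mem hE (Q.smul_mem c hψ)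
      have h0 : inner ℂ (errorOp v.1 v.2 ψ - c • ψ) (errorOp v.1 v.2 ψ - c • ψ) = 0 := by
        conv_lhs => arg 3; rw [sub_eq_add_neg]
        rw [inner_add_right, inner_neg_right, hc _ hd _ hψ, inner_smul_right, add_neg_cancel]
      exact sub_eq_zero.1 (inner_self_eq_zero.1 h0)
    have := hS.finite
    have ht := sum_trace_mul_eq (operatorRep S) (errorOp v.1 v.2) c
      (by rw [invariants_operatorRep hQ]; exact hact)
    rw [← Nat.cast_mul, invariants_operatorRep hQ, card_mul_finrank_of_trace hQ
      fun g hg => trace_eq_zero_of_ne_one hS hQ hQ0 hg] at ht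
    rw [finsum_eq_zero_of_forall_eq_zero] at ht
    · have hc0 : c = 0 := by
        have := natCast_pow_ne_zero (p := p) (n := n)
        simpa [NeZero.ne p] using ht.symm
      obtain ⟨ψ, hψ, hψ0⟩ := Q.ne_bot_iff.1 hQ0
      exact hψ0 (errorOp_injective v ψ (by rw [hact ψ hψ, hc0, zero_smul]))
    · intro g
      obtain ⟨d, a, b, h⟩ := hS g g.2
      have h' : operatorRep S g = (ZMod.stdAddChar d : ℂ) • errorOp a b := h
      rw [h', mul_smul_comm, errorOp_mul v (a, b), map_smul, map_smul, trace_errorOp, if_neg,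
        smul_zero, smul_zero]
      intro h0
      refine hv ?_
      rw [eq_neg_of_add_eq_zero_left h0]
      exact Submodule.neg_mem _ ⟨g, g.2, d, h⟩
  · rintro (⟨g, hg, d, h⟩ | hv)
    · refine ⟨(ZMod.stdAddChar d : ℂ)⁻¹, fun ψ _ φ hφ => ?_⟩
      have h1 : errorOp v.1 v.2 φ = (ZMod.stdAddChar d : ℂ)⁻¹ • φ := by
        rw [eq_inv_smul_iff₀ (stdAddChar_ne_zero _), ← LinearMap.smul_apply, ← h]
        exact (hQ φ).1 hφ g hg
      rw [← inner_smul_right, h1]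
    · rw [LinearMap.BilinForm.mem_orthogonal_iff] at hv
      push Not at hv
      obtain ⟨u, ⟨g, hg, d, h⟩, hu⟩ := hv
      refine ⟨0, fun ψ hψ φ hφ => ?_⟩
      rw [zero_mul]
      have hfix : ∀ χ ∈ Q, (ZMod.stdAddChar d : ℂ) • errorOp u.1 u.2 χ = χ := by
        intro χ hχ
        rw [← LinearMap.smul_apply, ← h]
        exact (hQ χ).1 hχ g hg
      have hun : ∀ χ χ' : QuditSpace p n,
          inner ℂ ((ZMod.stdAddChar d : ℂ) • errorOp u.1 u.2 χ)
            ((ZMod.stdAddChar d : ℂ) • errorOp u.1 u.2 χ') = inner ℂ χ χ' := by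
        intro χ χ'
        rw [inner_smul_left, inner_smul_right, inner_errorOp, ← mul_assoc,
          ← AddChar.map_neg_eq_conj, ← AddChar.map_add_eq_mul, neg_add_cancel,
          AddChar.map_zero_eq_one, one_mul]
      have hc := congrArg (fun f => (ZMod.stdAddChar d : ℂ) • f φ) (errorOp_comm u v)
      simp only [Module.End.mul_apply, LinearMap.smul_apply] at hc
      rw [smul_comm, ← map_smul (errorOp v.1 v.2), hfix φ hφ] at hc
      have h1 := hun ψ (errorOp v.1 v.2 φ)
      rw [hfix ψ hψ, hc, inner_smul_right] at h1
      have h2 : ((ZMod.stdAddChar (symplecticForm p n u v) : ℂ) - 1) *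
          inner ℂ ψ (errorOp v.1 v.2 φ) = 0 := by
        rw [sub_mul, h1, one_mul, sub_self]
      refine (mul_eq_zero.1 h2).resolve_left fun h3 => hu ?_
      apply ZMod.injective_stdAddChar (N := p)
      rw [AddChar.map_zero_eq_one]
      exact sub_eq_zero.1 h3

end StabilizerGroups

/-! ### Stabilizer codes from isotropic subspaces -/

section SymplecticCodes

variable {p n : ℕ}

/-- The symplectic description of an `[[n, k, d]]_p` stabilizer code: an isotropic subspace `L` of
dimension `n - k`, such that `d` is the least weight in the complement of `L` in its symplectic
orthogonal. -/
def IsSymplecticCode (p n k d : ℕ) (L : Submodule (ZMod p) (PhaseSpace p n)) : Prop :=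
  L ≤ (symplecticForm p n).orthogonal L ∧ Module.finrank (ZMod p) L + k = n ∧
  (∀ v ∈ (symplecticForm p n).orthogonal L, v ∉ L → d ≤ errorWeight v.1 v.2) ∧
  ∃ v ∈ (symplecticForm p n).orthogonal L, v ∉ L ∧ errorWeight v.1 v.2 = d

variable [Fact p.Prime]

theorem natCard_phaseSpace_submodule (L : Submodule (ZMod p) (PhaseSpace p n)) :
    Nat.card L = p ^ Module.finrank (ZMod p) L := by
  rw [Module.natCard_eq_pow_finrank (K := ZMod p), Nat.card_zmod]

variable [NeZero p]

theorem isSymplecticCode_errorLabels {k d : ℕ}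
    {S : Subgroup (QuditSpace p n ≃ₗ[ℂ] QuditSpace p n)} {Q : Submodule ℂ (QuditSpace p n)}
    (hS : IsErrorGroup S) (hQ : ∀ ψ, ψ ∈ Q ↔ ∀ g ∈ S, g ψ = ψ) (hQ0 : Q ≠ ⊥) :
    IsSymplecticCode p n k d (errorLabels S) ↔
      Module.finrank ℂ Q = p ^ k ∧ IsQuantumMinDist Q d := by
  have hp : 1 < p := (Fact.out : p.Prime).one_lt
  have := hS.finite
  have hcard := card_mul_finrank_of_trace hQ fun g hg => trace_eq_zero_of_ne_one hS hQ hQ0 hg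
  rw [← natCard_errorLabels hS hQ hQ0, natCard_phaseSpace_submodule] at hcard
  refine Iff.trans (and_iff_right (errorLabels_le_orthogonal hQ hQ0)) (and_congr ?_ (and_congr ?_ ?_))
  · constructor
    · intro h
      have hn : p ^ n = p ^ Module.finrank (ZMod p) (errorLabels S) * p ^ k := by
        rw [← pow_add, h]
      rw [hn] at hcard
      exact Nat.eq_of_mul_eq_mul_left (pow_pos (by omega) _) hcard
    · intro h
      rw [h, ← pow_add] at hcard
      exact Nat.pow_right_injective hp hcard
  · constructor
    · intro h a b hab
      rw [detectsError_iff hS hQ hQ0 (a, b)]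
      by_contra! hcon
      exact absurd (h (a, b) hcon.2 hcon.1) (not_le.2 hab)
    · intro h v hv hvL
      by_contra! hlt
      rcases (detectsError_iff hS hQ hQ0 v).1 (h v.1 v.2 hlt) with h | h
      exacts [hvL h, h hv]
  · constructor
    · rintro ⟨v, hv, hvL, hvd⟩
      refine ⟨v.1, v.2, hvd, ?_⟩
      rw [detectsError_iff hS hQ hQ0 v]
      tauto
    · rintro ⟨a, b, hab, hD⟩
      rw [detectsError_iff hS hQ hQ0 (a, b)] at hD
      exact ⟨(a, b), by tauto, by tauto, hab⟩

/-- The phases `ζ ^ (a · b / 2)` turn the errors with labels in an isotropic subspace into a group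
of operators, isomorphic to that subspace. -/
noncomputable def weylHom (hp : p ≠ 2) (L : Submodule (ZMod p) (PhaseSpace p n))
    (hL : L ≤ (symplecticForm p n).orthogonal L) :
    Multiplicative L →* Module.End ℂ (QuditSpace p n) where
  toFun u := (ZMod.stdAddChar (2⁻¹ * ((u.toAdd : PhaseSpace p n).1 ⬝ᵥ
    (u.toAdd : PhaseSpace p n).2)) : ℂ) •
      errorOp (u.toAdd : PhaseSpace p n).1 (u.toAdd : PhaseSpace p n).2
  map_one' := by
    simp only [toAdd_one, ZeroMemClass.coe_zero, Prod.fst_zero, Prod.snd_zero, errorOp_zero,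
      dotProduct_zero, mul_zero, AddChar.map_zero_eq_one, one_smul]
    rfl
  map_mul' := by
    intro u v
    have h := hL v.toAdd.2 _ u.toAdd.2
    rw [symplecticForm_apply] at h
    have h2 : (2 : ZMod p) ≠ 0 := by
      intro h0
      have := (Nat.prime_dvd_prime_iff_eq Fact.out Nat.prime_two).1
        ((ZMod.natCast_eq_zero_iff 2 p).1 (by exact_mod_cast h0))
      exact hp this
    rw [smul_mul_smul_comm, errorOp_mul, smul_smul, ← AddChar.map_add_eq_mul,
      ← AddChar.map_add_eq_mul, toAdd_mul, Submodule.coe_add]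
    congr 2
    simp only [Prod.fst_add, Prod.snd_add, add_dotProduct, dotProduct_add]
    rw [dotProduct_comm (u.toAdd : PhaseSpace p n).1 (v.toAdd : PhaseSpace p n).2,
      dotProduct_comm (v.toAdd : PhaseSpace p n).1 (u.toAdd : PhaseSpace p n).2]
    rw [← sub_eq_zero.1 h]
    field_simp
    ring

/-- Every isotropic subspace is the set of labels of a group of error operators in which only
the identity has nonzero trace. -/
theorem exists_errorGroup (hp : p ≠ 2) {L : Submodule (ZMod p) (PhaseSpace p n)}
    (hL : L ≤ (symplecticForm p n).orthogonal L) :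
    ∃ S : Subgroup (QuditSpace p n ≃ₗ[ℂ] QuditSpace p n), IsErrorGroup S ∧ errorLabels S = L ∧
      ∀ g ∈ S, g ≠ 1 → LinearMap.trace ℂ (QuditSpace p n) g = 0 := by
  let f : Multiplicative L →* (QuditSpace p n ≃ₗ[ℂ] QuditSpace p n) :=
    (LinearMap.GeneralLinearGroup.generalLinearEquiv ℂ (QuditSpace p n)).toMonoidHom.comp
      (weylHom hp L hL).toHomUnits
  have hf : ∀ u : L, ((f (Multiplicative.ofAdd u) : QuditSpace p n ≃ₗ[ℂ] QuditSpace p n) :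
      QuditSpace p n →ₗ[ℂ] QuditSpace p n) =
      (ZMod.stdAddChar (2⁻¹ * ((u : PhaseSpace p n).1 ⬝ᵥ (u : PhaseSpace p n).2)) : ℂ) •
        errorOp (u : PhaseSpace p n).1 (u : PhaseSpace p n).2 := fun u => by
    ext ψ : 1; rfl
  refine ⟨f.range, ?_, ?_, ?_⟩
  · rintro _ ⟨u, rfl⟩
    exact ⟨_, _, _, hf u.toAdd⟩
  · ext v
    constructor
    · rintro ⟨_, ⟨u, rfl⟩, c, h⟩
      rw [← errorOp_label_unique ((hf u.toAdd).symm.trans h)]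
      exact u.toAdd.2
    · intro hv
      exact ⟨_, ⟨Multiplicative.ofAdd ⟨v, hv⟩, rfl⟩, _, hf ⟨v, hv⟩⟩
  · rintro _ ⟨u, rfl⟩ h1
    have := hf u.toAdd
    rw [ofAdd_toAdd] at this
    rw [this, map_smul, trace_errorOp, if_neg, smul_zero]
    intro h0
    apply h1
    rw [← ofAdd_toAdd u, show u.toAdd = 0 from Subtype.ext h0, ofAdd_zero, map_one]

/-- Stabilizer codes on qudits of odd prime dimension are the same thing as isotropic subspaces
of phase space, parameters included. -/
theorem exists_isStabilizerCode_iff (hp : p ≠ 2) {k d : ℕ} :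
    (∃ Q, IsStabilizerCode p n k d Q) ↔ ∃ L, IsSymplecticCode p n k d L := by
  constructor
  · rintro ⟨Q, ⟨hQ0, S, hS, hQ⟩, h⟩
    exact ⟨errorLabels S, (isSymplecticCode_errorLabels hS hQ hQ0).2 h⟩
  · rintro ⟨L, hL⟩
    obtain ⟨S, hS, rfl, ht⟩ := exists_errorGroup hp hL.1
    let Q : Submodule ℂ (QuditSpace p n) := (operatorRep S).invariants
    have hQ : ∀ ψ, ψ ∈ Q ↔ ∀ g ∈ S, g ψ = ψ := fun ψ =>
      ⟨fun h g hg => h ⟨g, hg⟩, fun h g => h g g.2⟩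
    have := hS.finite
    have hcard := card_mul_finrank_of_trace hQ ht
    have hQ0 : Q ≠ ⊥ := by
      intro h0
      rw [h0, finrank_bot, mul_zero] at hcard
      exact pow_ne_zero n (NeZero.ne p) hcard.symm
    exact ⟨Q, ⟨hQ0, S, hS, hQ⟩, (isSymplecticCode_errorLabels hS hQ hQ0).1 hL⟩

end SymplecticCodes

/-! ### Errors supported on a set of positions -/

section Supported

variable {p n : ℕ}

/-- The labels of the errors that act as the identity outside the positions in `T`. -/
def supportedOn (p : ℕ) {n : ℕ} (T : Finset (Fin n)) : Submodule (ZMod p) (PhaseSpace p n) where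
  carrier := {v | ∀ i ∉ T, v.1 i = 0 ∧ v.2 i = 0}
  zero_mem' := fun _ _ => ⟨rfl, rfl⟩
  add_mem' := fun {u v} hu hv i hi => by simp [hu i hi, hv i hi]
  smul_mem' := fun c v hv i hi => by simp [hv i hi]

theorem mem_supportedOn {T : Finset (Fin n)} {v : PhaseSpace p n} :
    v ∈ supportedOn p T ↔ ∀ i ∉ T, v.1 i = 0 ∧ v.2 i = 0 := Iff.rfl

theorem supportedOn_mono {T U : Finset (Fin n)} (h : T ⊆ U) :
    supportedOn p T ≤ supportedOn p U := fun _ hv i hi => hv i fun hT => hi (h hT)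

theorem supportedOn_inf (T U : Finset (Fin n)) :
    supportedOn p T ⊓ supportedOn p U = supportedOn p (T ∩ U) := by
  refine le_antisymm (fun v hv i hi => ?_)
    (le_inf (supportedOn_mono Finset.inter_subset_left) (supportedOn_mono Finset.inter_subset_right))
  rw [Finset.mem_inter, not_and_or] at hi
  exact hi.elim (hv.1 i) (hv.2 i)

theorem errorWeight_le_of_mem_supportedOn {T : Finset (Fin n)} {v : PhaseSpace p n}
    (hv : v ∈ supportedOn p T) : errorWeight v.1 v.2 ≤ T.card := by
  refine Finset.card_le_card fun i hi => ?_
  by_contra hT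
  have := hv i hT
  simp [this] at hi

/-- The errors supported on `T` are those commuting with all errors supported off `T`. -/
theorem orthogonal_supportedOn_compl_le (T : Finset (Fin n)) :
    (symplecticForm p n).orthogonal (supportedOn p Tᶜ) ≤ supportedOn p T := by
  intro v hv i hi
  have h1 := hv (0, Pi.single i 1) (fun j hj => by
    have : j ≠ i := fun h => hj (by simpa [h] using hi)
    simp [this])
  have h2 := hv (Pi.single i 1, 0) (fun j hj => by
    have : j ≠ i := fun h => hj (by simpa [h] using hi)
    simp [this])
  exact ⟨(symplecticForm_single v i).1.symm.trans h1,
    neg_eq_zero.1 ((symplecticForm_single v i).2.symm.trans h2)⟩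

variable [Fact p.Prime]

theorem finrank_supportedOn (T : Finset (Fin n)) :
    Module.finrank (ZMod p) (supportedOn p T) = 2 * T.card := by
  let f : supportedOn p T →ₗ[ZMod p] (T → ZMod p) × (T → ZMod p) :=
    ((LinearMap.funLeft (ZMod p) (ZMod p) (Subtype.val : T → Fin n)).prodMap
      (LinearMap.funLeft (ZMod p) (ZMod p) (Subtype.val : T → Fin n))).comp
        (supportedOn p T).subtype
  have hf : Function.Bijective f := by
    constructor
    · rw [← LinearMap.ker_eq_bot, LinearMap.ker_eq_bot']
      intro v hv
      apply Subtype.ext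
      have h : ∀ i, (v : PhaseSpace p n).1 i = 0 ∧ (v : PhaseSpace p n).2 i = 0 := by
        intro i
        by_cases hi : i ∈ T
        · exact ⟨congrFun (congrArg Prod.fst hv) ⟨i, hi⟩, congrFun (congrArg Prod.snd hv) ⟨i, hi⟩⟩
        · exact v.2 i hi
      exact Prod.ext (funext fun i => (h i).1) (funext fun i => (h i).2)
    · rintro ⟨a, b⟩
      refine ⟨⟨(fun i => if h : i ∈ T then a ⟨i, h⟩ else 0,
        fun i => if h : i ∈ T then b ⟨i, h⟩ else 0), fun i hi => by simp [hi]⟩, ?_⟩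
      refine Prod.ext (funext fun i => ?_) (funext fun i => ?_)
      · exact dif_pos i.2
      · exact dif_pos i.2
  rw [(LinearEquiv.ofBijective f hf).finrank_eq]
  simp
  ring

theorem finrank_phaseSpace : Module.finrank (ZMod p) (PhaseSpace p n) = 2 * n := by
  simp
  ring

theorem finrank_orthogonal_add (L : Submodule (ZMod p) (PhaseSpace p n)) :
    Module.finrank (ZMod p) ((symplecticForm p n).orthogonal L) + Module.finrank (ZMod p) L =
      2 * n := by
  rw [LinearMap.BilinForm.finrank_orthogonal symplecticForm_nondegenerate, ← finrank_phaseSpace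
    (p := p)]
  exact Nat.sub_add_cancel (Submodule.finrank_le L)

/-- Each position outside `T` imposes at most two linear conditions on the elements of `L`. -/
theorem le_finrank_inf_supportedOn (L : Submodule (ZMod p) (PhaseSpace p n)) (T : Finset (Fin n)) :
    Module.finrank (ZMod p) L + 2 * T.card ≤
      2 * n + Module.finrank (ZMod p) (L ⊓ supportedOn p T : Submodule _ _) := by
  have h := Submodule.finrank_sup_add_finrank_inf_eq L (supportedOn p T)
  have h2 := Submodule.finrank_le (L ⊔ supportedOn p T)
  rw [finrank_phaseSpace] at h2
  rw [finrank_supportedOn] at h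
  omega

/-- Restricting the elements of `L` to `T` has the elements supported off `T` as kernel, and the
errors on `T` that commute with `L` are those orthogonal to its image. -/
theorem finrank_inf_compl_le (L : Submodule (ZMod p) (PhaseSpace p n)) (T : Finset (Fin n)) :
    Module.finrank (ZMod p) (L ⊓ supportedOn p Tᶜ : Submodule _ _) + 2 * T.card ≤
      Module.finrank (ZMod p) ((symplecticForm p n).orthogonal L ⊓ supportedOn p T : Submodule _ _)
        + Module.finrank (ZMod p) L := by
  have h := Submodule.finrank_sup_add_finrank_inf_eq L (supportedOn p Tᶜ)
  have h2 := finrank_orthogonal_add (L ⊔ supportedOn p Tᶜ)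
  have h3 : (symplecticForm p n).orthogonal (L ⊔ supportedOn p Tᶜ) ≤
      (symplecticForm p n).orthogonal L ⊓ supportedOn p T :=
    le_inf (LinearMap.BilinForm.orthogonal_le le_sup_left)
      ((LinearMap.BilinForm.orthogonal_le le_sup_right).trans (orthogonal_supportedOn_compl_le T))
  have h4 := Submodule.finrank_mono h3
  have h5 := Finset.card_compl_add_card T
  rw [Fintype.card_fin] at h5
  rw [finrank_supportedOn] at h
  omega

end Supported

/-! ### No `[[17, 7]]_3` code detects all errors of weight at most five -/

section Optimality

variable {L : Submodule (ZMod 3) (PhaseSpace 3 17)}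

/-- A code meeting the quantum Singleton bound is pure: its stabilizer has no elements supported on
`12` of the `17` positions. -/
theorem inf_supportedOn_eq_bot (hdim : Module.finrank (ZMod 3) L = 10)
    (hwt : ∀ v ∈ (symplecticForm 3 17).orthogonal L, errorWeight v.1 v.2 ≤ 5 → v ∈ L)
    {U : Finset (Fin 17)} (hU : U.card = 12) : L ⊓ supportedOn 3 U = ⊥ := by
  -- by cleaning, errors on a set of five positions and on its complement are equally numerous
  have key : ∀ T : Finset (Fin 17), T.card = 5 →
      Module.finrank (ZMod 3) (L ⊓ supportedOn 3 Tᶜ : Submodule _ _) ≤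
        Module.finrank (ZMod 3) (L ⊓ supportedOn 3 T : Submodule _ _) := by
    intro T hT
    have h1 := finrank_inf_compl_le L T
    have h2 : (symplecticForm 3 17).orthogonal L ⊓ supportedOn 3 T ≤ L ⊓ supportedOn 3 T :=
      fun v hv => ⟨hwt v hv.1 (hT ▸ errorWeight_le_of_mem_supportedOn hv.2), hv.2⟩
    have h3 := Submodule.finrank_mono h2
    omega
  have keyEq : ∀ T T' : Finset (Fin 17), T.card = 5 → T'.card = 5 → Disjoint T T' →
      L ⊓ supportedOn 3 T' = L ⊓ supportedOn 3 Tᶜ := by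
    intro T T' hT hT' hd
    have hle : L ⊓ supportedOn 3 T' ≤ L ⊓ supportedOn 3 Tᶜ :=
      inf_le_inf_left _ (supportedOn_mono (Finset.subset_compl_iff_disjoint_left.2 hd))
    have hle' : L ⊓ supportedOn 3 T ≤ L ⊓ supportedOn 3 T'ᶜ :=
      inf_le_inf_left _ (supportedOn_mono (Finset.subset_compl_iff_disjoint_right.2 hd))
    refine Submodule.eq_of_le_of_finrank_le hle ?_
    exact (key T hT).trans ((Submodule.finrank_mono hle').trans (key T' hT'))
  have hUc : Uᶜ.card = 5 := by rw [Finset.card_compl, hU, Fintype.card_fin]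
  obtain ⟨A, hA, hA5⟩ := Finset.exists_subset_card_eq (s := U) (n := 5) (by omega)
  obtain ⟨B, hB, hB5⟩ := Finset.exists_subset_card_eq (s := U \ A) (n := 5)
    (by rw [Finset.card_sdiff_of_subset hA]; omega)
  have hdA : Disjoint Uᶜ A := disjoint_compl_left.mono_right hA
  have hdB : Disjoint Uᶜ B :=
    disjoint_compl_left.mono_right (hB.trans Finset.sdiff_subset)
  have eA := keyEq _ _ hUc hA5 hdA
  have eB := keyEq _ _ hUc hB5 hdB
  rw [compl_compl] at eA eB
  have hAB : A ∩ B = ∅ := by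
    rw [← Finset.disjoint_iff_inter_eq_empty]
    exact (Finset.disjoint_sdiff).mono_right hB
  rw [eq_bot_iff]
  intro v hv
  have h1 : v ∈ supportedOn 3 A ⊓ supportedOn 3 B := ⟨(eA ▸ hv : v ∈ L ⊓ supportedOn 3 A).2,
    (eB ▸ hv : v ∈ L ⊓ supportedOn 3 B).2⟩
  rw [supportedOn_inf, hAB, mem_supportedOn] at h1
  exact Prod.ext (funext fun i => (h1 i (by simp)).1) (funext fun i => (h1 i (by simp)).2)

theorem exists_finset_of_submodule {p n : ℕ} [NeZero p]
    (N : Submodule (ZMod p) (PhaseSpace p n)) :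
    ∃ A : Finset (PhaseSpace p n), (∀ v, v ∈ A ↔ v ∈ N) ∧ A.card = Nat.card N := by
  refine ⟨(Set.toFinite (N : Set (PhaseSpace p n))).toFinset, fun v => ?_, ?_⟩
  · rw [Set.Finite.mem_toFinset]; rfl
  · exact (Nat.card_eq_card_finite_toFinset _).symm

/-- Counting: on `14` positions the stabilizer would have at most `81` elements, but at least
`14 * 8` elements of weight `13`. -/
theorem false_of_detects_five (hdim : Module.finrank (ZMod 3) L = 10)
    (hwt : ∀ v ∈ (symplecticForm 3 17).orthogonal L, errorWeight v.1 v.2 ≤ 5 → v ∈ L) : False := by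
  classical
  obtain ⟨U, -, hU⟩ := Finset.exists_subset_card_eq (s := (Finset.univ : Finset (Fin 17))) (n := 14)
    (by simp)
  have hpure := fun (W : Finset (Fin 17)) hW => inf_supportedOn_eq_bot hdim hwt (U := W) hW
  have hN : Nat.card (L ⊓ supportedOn 3 U : Submodule _ _) ≤ 81 := by
    obtain ⟨W, hWU, hW⟩ := Finset.exists_subset_card_eq (s := U) (n := 12) (by omega)
    have h1 := Submodule.finrank_sup_add_finrank_inf_eq (L ⊓ supportedOn 3 U) (supportedOn 3 W)
    have h2 : (L ⊓ supportedOn 3 U) ⊓ supportedOn 3 W = ⊥ := by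
      rw [inf_assoc, supportedOn_inf, Finset.inter_eq_right.2 hWU, hpure W hW]
    have h3 := Submodule.finrank_mono
      (sup_le inf_le_right (supportedOn_mono hWU) :
        (L ⊓ supportedOn 3 U) ⊔ supportedOn 3 W ≤ supportedOn 3 U)
    rw [h2, finrank_bot, finrank_supportedOn] at h1
    rw [finrank_supportedOn] at h3
    rw [natCard_phaseSpace_submodule]
    exact Nat.pow_le_pow_right (by norm_num) (by omega : _ ≤ 4)
  obtain ⟨A, hA, hAcard⟩ := exists_finset_of_submodule (L ⊓ supportedOn 3 U)
  choose B hB hBcard using fun i => exists_finset_of_submodule (L ⊓ supportedOn 3 (U.erase i))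
  have hM : ∀ i ∈ U, 8 ≤ ((B i).erase 0).card := by
    intro i hi
    have h1 := le_finrank_inf_supportedOn L (U.erase i)
    rw [Finset.card_erase_of_mem hi] at h1
    have h2 : 3 ^ 2 ≤ (B i).card := by
      rw [hBcard, natCard_phaseSpace_submodule]
      exact Nat.pow_le_pow_right (by norm_num) (by omega)
    rw [Finset.card_erase_of_mem ((hB i 0).2 (Submodule.zero_mem _))]
    omega
  have hdisj : ∀ i ∈ U, ∀ j ∈ U, i ≠ j → Disjoint ((B i).erase 0) ((B j).erase 0) := by
    intro i hi j hj hij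
    rw [Finset.disjoint_left]
    intro v hvi hvj
    rw [Finset.mem_erase, hB] at hvi hvj
    have h12 : ((U.erase i) ∩ (U.erase j)).card = 12 := by
      have : (U.erase i) ∩ (U.erase j) = (U.erase i).erase j := by
        ext x; simp only [Finset.mem_inter, Finset.mem_erase]; tauto
      rw [this, Finset.card_erase_of_mem (Finset.mem_erase.2 ⟨hij.symm, hj⟩),
        Finset.card_erase_of_mem hi, hU]
    have h0 : v ∈ L ⊓ supportedOn 3 ((U.erase i) ∩ (U.erase j)) := by
      rw [← supportedOn_inf]
      exact ⟨hvi.2.1, hvi.2.2, hvj.2.2⟩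
    rw [hpure _ h12, Submodule.mem_bot] at h0
    exact hvi.1 h0
  have hsum : U.card * 8 ≤ (U.biUnion fun i => (B i).erase 0).card := by
    rw [Finset.card_biUnion hdisj, ← smul_eq_mul]
    exact Finset.card_nsmul_le_sum _ _ _ hM
  have hsub : (U.biUnion fun i => (B i).erase 0).card ≤ A.card := by
    refine Finset.card_le_card (Finset.biUnion_subset.2 fun i _ v hvi => ?_)
    rw [Finset.mem_erase, hB] at hvi
    exact (hA v).2 ⟨hvi.2.1, supportedOn_mono (Finset.erase_subset _ _) hvi.2.2⟩
  omega

theorem IsSymplecticCode.distance_le_five {d : ℕ} (h : IsSymplecticCode 3 17 7 d L) : d ≤ 5 := by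
  obtain ⟨-, hdim, hwt, -⟩ := h
  by_contra! hd
  refine false_of_detects_five (L := L) (by omega) fun v hv h5 => ?_
  by_contra hvL
  have := hwt v hv hvL
  omega

end Optimality

/-! ### Propagation rules -/

section Propagation

variable {p n k d : ℕ}

/-- Subcodes: the stabilizer is enlarged by an error that commutes with a given undetected error of
least weight. -/
theorem IsSymplecticCode.exists_subcode [Fact p.Prime] (hk : 1 ≤ k) {L : Submodule (ZMod p) (PhaseSpace p n)}
    (h : IsSymplecticCode p n (k + 1) d L) : ∃ L', IsSymplecticCode p n k d L' := by
  obtain ⟨hL, hdim, hwt, w, hw, hwL, hwd⟩ := h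
  have hrefl := symplecticForm_isRefl (p := p) (n := n)
  have hself : ∀ u : PhaseSpace p n, symplecticForm p n u u = 0 := fun u => sub_self _
  have hspan : ∀ {M : Submodule (ZMod p) (PhaseSpace p n)} {u x : PhaseSpace p n},
      x ∈ (symplecticForm p n).orthogonal (M ⊔ Submodule.span (ZMod p) {u}) ↔
        x ∈ (symplecticForm p n).orthogonal M ∧ symplecticForm p n u x = 0 := by
    intro M u x
    constructor
    · intro hx
      exact ⟨LinearMap.BilinForm.orthogonal_le le_sup_left hx,
        hx u (Submodule.mem_sup_right (Submodule.mem_span_singleton_self u))⟩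
    · rintro ⟨hx, hux⟩ y hy
      obtain ⟨m, hm, z, hz, rfl⟩ := Submodule.mem_sup.1 hy
      obtain ⟨c, rfl⟩ := Submodule.mem_span_singleton.1 hz
      have := hx m hm
      simp only [map_add, map_smul, LinearMap.add_apply, LinearMap.smul_apply, hux, smul_zero,
        add_zero]
      exact this
  have hrank : ∀ {M : Submodule (ZMod p) (PhaseSpace p n)} {u : PhaseSpace p n}, u ∉ M →
      Module.finrank (ZMod p) (M ⊔ Submodule.span (ZMod p) {u} : Submodule _ _) =
        Module.finrank (ZMod p) M + 1 := by
    intro M u hu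
    have h0 : u ≠ 0 := fun h0 => hu (h0 ▸ M.zero_mem)
    have h1 := Submodule.finrank_sup_add_finrank_inf_eq M (Submodule.span (ZMod p) {u})
    rw [((Submodule.disjoint_span_singleton' h0).2 hu).eq_bot, finrank_bot,
      finrank_span_singleton h0] at h1
    exact h1
  let M := L ⊔ Submodule.span (ZMod p) {w}
  have hM : Module.finrank (ZMod p) M = Module.finrank (ZMod p) L + 1 := hrank hwL
  obtain ⟨s, hs, hsM⟩ : ∃ s ∈ (symplecticForm p n).orthogonal M, s ∉ M := by
    by_contra! hcon
    have h1 := Submodule.finrank_mono (show _ ≤ M from hcon)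
    have h2 := finrank_orthogonal_add M
    omega
  obtain ⟨hsL, hsw⟩ := hspan.1 hs
  have hsL' : s ∉ L := fun h => hsM (Submodule.mem_sup_left h)
  refine ⟨L ⊔ Submodule.span (ZMod p) {s}, ?_, ?_, ?_, w, ?_, ?_, hwd⟩
  · refine sup_le (fun x hx => hspan.2 ⟨hL hx, hrefl _ _ (hsL x hx)⟩) ?_
    rw [Submodule.span_singleton_le_iff_mem]
    exact hspan.2 ⟨hsL, hself s⟩
  · rw [hrank hsL']; omega
  · intro v hv hvL
    exact hwt v (hspan.1 hv).1 fun h => hvL (Submodule.mem_sup_left h)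
  · exact hspan.2 ⟨hw, hrefl _ _ hsw⟩
  · intro hmem
    obtain ⟨m, hm, z, hz, hmz⟩ := Submodule.mem_sup.1 hmem
    obtain ⟨c, rfl⟩ := Submodule.mem_span_singleton.1 hz
    have hc : c ≠ 0 := by
      rintro rfl
      rw [zero_smul, add_zero] at hmz
      exact hwL (hmz ▸ hm)
    apply hsM
    have : s = c⁻¹ • (w - m) := by
      rw [← hmz, add_sub_cancel_left, smul_smul, inv_mul_cancel₀ hc, one_smul]
    rw [this]
    exact M.smul_mem _ (M.sub_mem (Submodule.mem_sup_right (Submodule.mem_span_singleton_self w))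
      (Submodule.mem_sup_left hm))

/-- The linear map forgetting the last position. -/
def forgetLast (p n : ℕ) : PhaseSpace p (n + 1) →ₗ[ZMod p] PhaseSpace p n :=
  (LinearMap.funLeft (ZMod p) (ZMod p) Fin.castSucc).prodMap
    (LinearMap.funLeft (ZMod p) (ZMod p) Fin.castSucc)

/-- The symplectic form, with the contribution of the last position split off. -/
theorem symplecticForm_succ (u v : PhaseSpace p (n + 1)) :
    symplecticForm p (n + 1) u v = symplecticForm p n (forgetLast p n u) (forgetLast p n v) +
      (u.2 (Fin.last n) * v.1 (Fin.last n) - v.2 (Fin.last n) * u.1 (Fin.last n)) := by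
  simp only [symplecticForm_apply, dotProduct, Fin.sum_univ_castSucc, forgetLast,
    LinearMap.prodMap_apply, LinearMap.funLeft_apply]
  ring

/-- The label that extends `u` by `(a, b)` in a new last position. -/
def extendLast (u : PhaseSpace p n) (a b : ZMod p) : PhaseSpace p (n + 1) :=
  (Fin.snoc u.1 a, Fin.snoc u.2 b)

theorem forgetLast_extendLast (u : PhaseSpace p n) (a b : ZMod p) :
    forgetLast p n (extendLast u a b) = u := by
  ext i <;> simp [forgetLast, extendLast]

theorem errorWeight_forgetLast_le (v : PhaseSpace p (n + 1)) :
    errorWeight (forgetLast p n v).1 (forgetLast p n v).2 ≤ errorWeight v.1 v.2 := by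
  refine Finset.card_le_card_of_injOn Fin.castSucc (fun i hi => ?_)
    (Fin.castSucc_injective n).injOn
  rw [Finset.mem_coe, Finset.mem_filter] at hi ⊢
  exact ⟨Finset.mem_univ _, hi.2⟩

theorem errorWeight_extendLast_zero (u : PhaseSpace p n) :
    errorWeight (extendLast u 0 0).1 (extendLast u 0 0).2 = errorWeight u.1 u.2 := by
  symm
  refine Finset.card_bij (fun i _ => Fin.castSucc i) (fun i hi => ?_)
    (fun _ _ _ _ h => Fin.castSucc_injective n h) (fun j hj => ?_)
  · rw [Finset.mem_filter] at hi ⊢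
    simpa only [extendLast, Fin.snoc_castSucc, Finset.mem_univ, true_and] using hi
  · rw [Finset.mem_filter] at hj
    induction j using Fin.lastCases with
    | last => simp [extendLast] at hj
    | cast i =>
      refine ⟨i, Finset.mem_filter.2 ?_, rfl⟩
      simpa only [extendLast, Fin.snoc_castSucc, Finset.mem_univ, true_and] using hj

/-- Lengthening: a qudit in the state `|0⟩`, stabilized by `Z`, is appended. -/
theorem IsSymplecticCode.exists_lengthening [Fact p.Prime] {L : Submodule (ZMod p) (PhaseSpace p n)}
    (h : IsSymplecticCode p n k d L) : ∃ L', IsSymplecticCode p (n + 1) k d L' := by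
  obtain ⟨hL, hdim, hwt, w, hw, hwL, hwd⟩ := h
  let xLast : PhaseSpace p (n + 1) →ₗ[ZMod p] ZMod p :=
    (LinearMap.proj (Fin.last n)).comp (LinearMap.fst (ZMod p) _ _)
  let L' : Submodule (ZMod p) (PhaseSpace p (n + 1)) :=
    L.comap (forgetLast p n) ⊓ LinearMap.ker xLast
  have hmem : ∀ v, v ∈ L' ↔ forgetLast p n v ∈ L ∧ v.1 (Fin.last n) = 0 := fun v => Iff.rfl
  have horth : ∀ v, v ∈ (symplecticForm p (n + 1)).orthogonal L' ↔
      forgetLast p n v ∈ (symplecticForm p n).orthogonal L ∧ v.1 (Fin.last n) = 0 := by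
    intro v
    constructor
    · intro hv
      have h1 := hv (extendLast 0 0 1) ((hmem _).2
        ⟨by rw [forgetLast_extendLast]; exact L.zero_mem, by simp [extendLast]⟩)
      have h1' : v.1 (Fin.last n) = 0 := by
        rw [symplecticForm_succ, forgetLast_extendLast] at h1
        simpa [extendLast] using h1
      refine ⟨fun u hu => ?_, h1'⟩
      have h2 := hv (extendLast u 0 0) ((hmem _).2
        ⟨by rwa [forgetLast_extendLast], by simp [extendLast]⟩)
      rw [symplecticForm_succ, forgetLast_extendLast] at h2
      simpa [extendLast] using h2
    · rintro ⟨hv, hv0⟩ u hu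
      obtain ⟨hu1, hu0⟩ := (hmem u).1 hu
      have h2 := hv _ hu1
      rw [symplecticForm_succ, hv0, hu0, mul_zero, mul_zero, sub_zero, add_zero]
      exact h2
  refine ⟨L', ?_, ?_, ?_, extendLast w 0 0, ?_, ?_, ?_⟩
  · intro v hv
    obtain ⟨h1, h0⟩ := (hmem v).1 hv
    exact (horth v).2 ⟨hL h1, h0⟩
  · let f : L' →ₗ[ZMod p] L × ZMod p :=
      LinearMap.prod (((forgetLast p n).comp L'.subtype).codRestrict L fun v => v.2.1)
        (((LinearMap.proj (Fin.last n)).comp (LinearMap.snd (ZMod p) _ _)).comp L'.subtype)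
    have hf : Function.Bijective f := by
      constructor
      · rw [← LinearMap.ker_eq_bot, LinearMap.ker_eq_bot']
        intro v hv
        have h1 : forgetLast p n v = 0 := congrArg (fun x => (x.1 : PhaseSpace p n)) hv
        have h2 : (v : PhaseSpace p (n + 1)).2 (Fin.last n) = 0 := congrArg Prod.snd hv
        apply Subtype.ext
        refine Prod.ext (funext fun j => ?_) (funext fun j => ?_)
        · induction j using Fin.lastCases with
          | last => exact v.2.2
          | cast i => exact congrFun (congrArg Prod.fst h1) i
        · induction j using Fin.lastCases with
          | last => exact h2
          | cast i => exact congrFun (congrArg Prod.snd h1) i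
      · rintro ⟨u, b⟩
        refine ⟨⟨extendLast u 0 b, (hmem _).2
          ⟨by rw [forgetLast_extendLast]; exact u.2, by simp [extendLast]⟩⟩, ?_⟩
        refine Prod.ext (Subtype.ext (forgetLast_extendLast _ _ _)) ?_
        change (extendLast (u : PhaseSpace p n) 0 b).2 (Fin.last n) = b
        simp [extendLast]
    rw [(LinearEquiv.ofBijective f hf).finrank_eq, Module.finrank_prod, Module.finrank_self]
    omega
  · intro v hv hvL
    obtain ⟨h1, h0⟩ := (horth v).1 hv
    exact (hwt _ h1 fun h => hvL ((hmem v).2 ⟨h, h0⟩)).trans (errorWeight_forgetLast_le v)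
  · exact (horth _).2 ⟨by rwa [forgetLast_extendLast], by simp [extendLast]⟩
  · intro hcon
    have := ((hmem _).1 hcon).1
    rw [forgetLast_extendLast] at this
    exact hwL this
  · rw [errorWeight_extendLast_zero, hwd]

end Propagation

/-! ### Stabilizer codes from Hermitian self-orthogonal codes over the field with nine elements -/

section HermitianConstruction

variable {F : Type*} [Field F] {n : ℕ}

theorem mem_hermitianDual {q : ℕ} {E : Submodule F (Fin n → F)} {v : Fin n → F} :
    v ∈ hermitianDual q E ↔ ∀ u ∈ E, ∑ i, v i * u i ^ q = 0 := Iff.rfl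

variable [CharP F 3]

/-- The coordinates `(a, b)` of `a + b ω`, position by position. -/
def ofPhaseSpace (ω : F) (n : ℕ) : PhaseSpace 3 n →+ (Fin n → F) where
  toFun v i := ZMod.castHom (dvd_refl 3) F (v.1 i) + ZMod.castHom (dvd_refl 3) F (v.2 i) * ω
  map_zero' := by ext; simp
  map_add' u v := by
    ext i
    simp only [Prod.fst_add, Prod.snd_add, Pi.add_apply, map_add]
    ring

theorem ofPhaseSpace_apply (ω : F) (v : PhaseSpace 3 n) (i : Fin n) :
    ofPhaseSpace ω n v i =
      ZMod.castHom (dvd_refl 3) F (v.1 i) + ZMod.castHom (dvd_refl 3) F (v.2 i) * ω := rfl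

theorem castHom_pow_three (c : ZMod 3) :
    ZMod.castHom (dvd_refl 3) F c ^ 3 = ZMod.castHom (dvd_refl 3) F c := by
  rw [← map_pow, ZMod.pow_card]

theorem add_pow_three (x y : F) : (x + y) ^ 3 = x ^ 3 + y ^ 3 := by
  exact add_pow_char x y 3

theorem sum_pow_three {ι : Type*} (s : Finset ι) (f : ι → F) :
    (∑ i ∈ s, f i) ^ 3 = ∑ i ∈ s, f i ^ 3 := by
  exact sum_pow_char 3 s f

variable {ω : F}

theorem castHom_add_mul_eq_zero_iff (hω : ω ^ 3 ≠ ω) (a b : ZMod 3) :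
    ZMod.castHom (dvd_refl 3) F a + ZMod.castHom (dvd_refl 3) F b * ω = 0 ↔ a = 0 ∧ b = 0 := by
  constructor
  · intro h
    have hb : b = 0 := by
      by_contra hb
      apply hω
      have h1 : ω = ZMod.castHom (dvd_refl 3) F (-a / b) := by
        rw [map_div₀, map_neg, eq_div_iff ((_root_.map_ne_zero _).2 hb)]
        linear_combination h
      rw [h1, castHom_pow_three]
    subst hb
    rw [map_zero, zero_mul, add_zero, map_eq_zero] at h
    exact ⟨h, rfl⟩
  · rintro ⟨rfl, rfl⟩
    simp

theorem ofPhaseSpace_injective (hω : ω ^ 3 ≠ ω) : Function.Injective (ofPhaseSpace ω n) := by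
  rw [injective_iff_map_eq_zero]
  intro v hv
  have h := fun i => (castHom_add_mul_eq_zero_iff hω (v.1 i) (v.2 i)).1 (congrFun hv i)
  exact Prod.ext (funext fun i => (h i).1) (funext fun i => (h i).2)

theorem hammingNorm_ofPhaseSpace [DecidableEq F] (hω : ω ^ 3 ≠ ω) (v : PhaseSpace 3 n) :
    hammingNorm (ofPhaseSpace ω n v) = errorWeight v.1 v.2 := by
  refine congrArg Finset.card (Finset.filter_congr fun i _ => ?_)
  rw [ofPhaseSpace_apply, Ne, castHom_add_mul_eq_zero_iff hω]
  tauto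

theorem ofPhaseSpace_bijective [Fintype F] (hF : Fintype.card F = 9) (hω : ω ^ 3 ≠ ω) :
    Function.Bijective (ofPhaseSpace ω n) := by
  rw [Fintype.bijective_iff_injective_and_card]
  refine ⟨ofPhaseSpace_injective hω, ?_⟩
  rw [Fintype.card_prod, Fintype.card_fun, Fintype.card_fun, ZMod.card, hF, Fintype.card_fin,
    ← mul_pow]
  norm_num

/-- The symplectic form is, up to the scalar `ω ^ 3 - ω`, the difference of the Hermitian form and
its conjugate. -/
theorem symplecticForm_eq_hermitian [Fintype F] (hF : Fintype.card F = 9) (u v : PhaseSpace 3 n) :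
    ZMod.castHom (dvd_refl 3) F (symplecticForm 3 n u v) * (ω ^ 3 - ω) =
      ∑ i, ofPhaseSpace ω n v i * ofPhaseSpace ω n u i ^ 3 -
        (∑ i, ofPhaseSpace ω n v i * ofPhaseSpace ω n u i ^ 3) ^ 3 := by
  have h9 : ω ^ 9 = ω := by rw [← hF]; exact FiniteField.pow_card ω
  rw [sum_pow_three, ← Finset.sum_sub_distrib, symplecticForm_apply, map_sub]
  simp only [dotProduct, map_sum, map_mul]
  rw [← Finset.sum_sub_distrib, Finset.sum_mul]
  refine Finset.sum_congr rfl fun i _ => ?_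
  simp only [ofPhaseSpace_apply, mul_pow, add_pow_three, castHom_pow_three, ← pow_mul]
  norm_num [h9]
  ring

/-- The `ZMod 3`-subspace of phase space that corresponds to a code over the field with nine
elements. -/
def phaseSubmodule (ω : F) (E : Submodule F (Fin n → F)) : Submodule (ZMod 3) (PhaseSpace 3 n) where
  carrier := {v | ofPhaseSpace ω n v ∈ E}
  zero_mem' := by simp [E.zero_mem]
  add_mem' hu hv := by
    simp only [Set.mem_ofPred_eq, map_add] at *
    exact E.add_mem hu hv
  smul_mem' c v hv := by
    have : ofPhaseSpace ω n (c • v) = ZMod.castHom (dvd_refl 3) F c • ofPhaseSpace ω n v := by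
      ext i
      simp only [ofPhaseSpace_apply, Prod.smul_fst, Prod.smul_snd, Pi.smul_apply, smul_eq_mul,
        map_mul]
      ring
    simp only [Set.mem_ofPred_eq, this] at *
    exact E.smul_mem _ hv

theorem mem_phaseSubmodule {E : Submodule F (Fin n → F)} {v : PhaseSpace 3 n} :
    v ∈ phaseSubmodule ω E ↔ ofPhaseSpace ω n v ∈ E := Iff.rfl

theorem finrank_phaseSubmodule [Fintype F] (hF : Fintype.card F = 9) (hω : ω ^ 3 ≠ ω)
    (E : Submodule F (Fin n → F)) :
    Module.finrank (ZMod 3) (phaseSubmodule ω E) = 2 * Module.finrank F E := by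
  have h1 : Nat.card (phaseSubmodule ω E) = Nat.card E :=
    Nat.card_congr ((Equiv.ofBijective _ (ofPhaseSpace_bijective hF hω)).subtypeEquiv
      fun _ => Iff.rfl)
  rw [natCard_phaseSpace_submodule, Module.natCard_eq_pow_finrank (K := F),
    Nat.card_eq_fintype_card, hF, show 9 = 3 ^ 2 by norm_num, ← pow_mul] at h1
  exact Nat.pow_right_injective (by norm_num : 2 ≤ 3) h1

theorem orthogonal_phaseSubmodule [Fintype F] (hF : Fintype.card F = 9) (hω : ω ^ 3 ≠ ω)
    (E : Submodule F (Fin n → F)) :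
    (symplecticForm 3 n).orthogonal (phaseSubmodule ω E) =
      phaseSubmodule ω (hermitianDual 3 E) := by
  have hω' : ω ^ 3 - ω ≠ 0 := sub_ne_zero.2 hω
  ext v
  rw [mem_phaseSubmodule, mem_hermitianDual]
  constructor
  · intro hv
    have hfix : ∀ e ∈ E, (∑ i, ofPhaseSpace ω n v i * e i ^ 3) ^ 3 =
        ∑ i, ofPhaseSpace ω n v i * e i ^ 3 := by
      intro e he
      obtain ⟨u, rfl⟩ := (ofPhaseSpace_bijective hF hω).2 e
      have h := symplecticForm_eq_hermitian (ω := ω) hF u v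
      rw [hv u he, map_zero, zero_mul] at h
      exact (sub_eq_zero.1 h.symm).symm
    intro e he
    have h1 := hfix e he
    have h2 := hfix (ω • e) (E.smul_mem _ he)
    have h3 : ∑ i, ofPhaseSpace ω n v i * (ω • e) i ^ 3 =
        ω ^ 3 * ∑ i, ofPhaseSpace ω n v i * e i ^ 3 := by
      rw [Finset.mul_sum]
      refine Finset.sum_congr rfl fun i _ => ?_
      rw [Pi.smul_apply, smul_eq_mul]; ring
    have h9 : ω ^ 9 = ω := by rw [← hF]; exact FiniteField.pow_card ω
    rw [h3, mul_pow, h1, ← pow_mul, h9] at h2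
    have h4 : (ω ^ 3 - ω) * ∑ i, ofPhaseSpace ω n v i * e i ^ 3 = 0 := by
      rw [sub_mul, h2, sub_self]
    exact (mul_eq_zero.1 h4).resolve_left hω'
  · intro hv u hu
    have h := symplecticForm_eq_hermitian (ω := ω) hF u v
    rw [hv _ hu] at h
    have h2 : ZMod.castHom (dvd_refl 3) F (symplecticForm 3 n u v) = 0 :=
      (mul_eq_zero.1 (h.trans (by norm_num))).resolve_right hω'
    exact (map_eq_zero _).1 h2

/-- A Hermitian self-orthogonal code whose dual has minimum distance at least `d` gives a pure
stabilizer code; the distance is `d` if a word of weight `d` lies in the dual but not in the code.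
-/
theorem exists_isSymplecticCode_of_hermitian [Fintype F] [DecidableEq F]
    (hF : Fintype.card F = 9)
    (hω : ω ^ 3 ≠ ω) {E : Submodule F (Fin n → F)} {k d : ℕ} (hE : E ≤ hermitianDual 3 E)
    (hdim : 2 * Module.finrank F E + k = n)
    (hwt : ∀ v ∈ hermitianDual 3 E, v ≠ 0 → d ≤ hammingNorm v)
    (hd : ∃ v ∈ hermitianDual 3 E, v ∉ E ∧ hammingNorm v = d) :
    ∃ L, IsSymplecticCode 3 n k d L := by
  refine ⟨phaseSubmodule ω E, ?_, ?_, ?_, ?_⟩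
  · rw [orthogonal_phaseSubmodule hF hω]
    exact fun v hv => hE hv
  · rw [finrank_phaseSubmodule hF hω, hdim]
  · intro v hv hvE
    rw [orthogonal_phaseSubmodule hF hω] at hv
    rw [← hammingNorm_ofPhaseSpace hω]
    refine hwt _ hv fun h0 => hvE ?_
    rw [mem_phaseSubmodule, h0]
    exact E.zero_mem
  · obtain ⟨w, hw, hwE, hwd⟩ := hd
    obtain ⟨v, rfl⟩ := (ofPhaseSpace_bijective hF hω).2 w
    refine ⟨v, ?_, hwE, ?_⟩
    · rw [orthogonal_phaseSubmodule hF hω]; exact hw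
    · rw [← hammingNorm_ofPhaseSpace hω, hwd]

end HermitianConstruction

/-! ### Quasi-cyclic codes of length `8 * 2` and their spectral description -/

section SpectralCodes

theorem arrayEntry_ext {F : Type*} {m l : ℕ} {c d : Fin (m * l) → F}
    (h : ∀ g t, arrayEntry c g t = arrayEntry d g t) : c = d := by
  funext i
  have := h (finProdFinEquiv.symm i).1 (finProdFinEquiv.symm i).2
  simpa only [arrayEntry, Prod.mk.eta, Equiv.apply_symm_apply] using this

variable {F : Type*} [Field F] {ω : F}

theorem evalAt_apply {m l : ℕ} (a : F) (c : Fin (m * l) → F) (t : Fin l) :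
    evalAt m l a c t = ∑ g : Fin m, arrayEntry c g t * a ^ (g : ℕ) := by
  simp [evalAt, columnPoly, eval_finsetSum]

theorem sum_eq_sum_arrayEntry {m l : ℕ} (f : Fin (m * l) → F) :
    ∑ i, f i = ∑ t : Fin l, ∑ g : Fin m, arrayEntry f g t := by
  rw [← Equiv.sum_comp finProdFinEquiv, Fintype.sum_prod_type_right]
  rfl

/-- The eighth roots of unity, as powers of `ω`. -/
def root (ω : F) (j : ZMod 8) : F := ω ^ j.val

theorem root_add (hω : orderOf ω = 8) (i j : ZMod 8) : root ω (i + j) = root ω i * root ω j := by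
  have h := pow_mod_orderOf ω (i.val + j.val)
  rw [hω, pow_add] at h
  rw [root, ZMod.val_add, h, root, root]

theorem root_zero : root ω 0 = 1 := by simp [root]

theorem root_natCast_mul (hω : orderOf ω = 8) (k : ℕ) (j : ZMod 8) :
    root ω (k * j) = root ω j ^ k := by
  induction k with
  | zero => simp [root_zero]
  | succ k ih => rw [Nat.cast_succ, add_mul, one_mul, root_add hω, ih, pow_succ]

theorem root_pow_eight (hω : orderOf ω = 8) (j : ZMod 8) : root ω j ^ 8 = 1 := by
  rw [← root_natCast_mul hω, show ((8 : ℕ) : ZMod 8) = 0 from rfl, zero_mul, root_zero]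

theorem root_injective (hω : orderOf ω = 8) : Function.Injective (root ω) := by
  intro i j h
  have := pow_injOn_Iio_orderOf (x := ω) (by simpa [hω] using i.val_lt)
    (by simpa [hω] using j.val_lt) h
  exact ZMod.val_injective 8 this

theorem sum_root_pow (hω : orderOf ω = 8) {j : ZMod 8} (hj : j ≠ 0) :
    ∑ g : Fin 8, root ω j ^ (g : ℕ) = 0 := by
  have h1 : root ω j ≠ 1 := fun h => hj (root_injective hω (h.trans root_zero.symm))
  rw [Fin.sum_univ_eq_sum_range (fun g => root ω j ^ g), geom_sum_eq h1, root_pow_eight hω,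
    sub_self, zero_div]

/-- The word of length `8 * 2` whose evaluation at `root ω j` is `-w`, and whose evaluations at the
other eighth roots of unity are zero. -/
def spectralWord (ω : F) (j : ZMod 8) (w : Fin 2 → F) : Fin (8 * 2) → F := fun i =>
  w (finProdFinEquiv.symm i).2 * root ω (-j) ^ ((finProdFinEquiv.symm i).1 : ℕ)

theorem arrayEntry_spectralWord (j : ZMod 8) (w : Fin 2 → F) (g : Fin 8) (t : Fin 2) :
    arrayEntry (spectralWord ω j w) g t = w t * root ω (-j) ^ (g : ℕ) := by
  simp only [arrayEntry, spectralWord, Equiv.symm_apply_apply]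

theorem natCast_eight [CharP F 3] : (8 : F) = -1 := by
  have h := CharP.cast_eq_zero F 3
  push_cast at h
  linear_combination 3 * h

theorem evalAt_spectralWord [CharP F 3] (hω : orderOf ω = 8) (i j : ZMod 8) (w : Fin 2 → F) :
    evalAt 8 2 (root ω i) (spectralWord ω j w) = if i = j then -w else 0 := by
  funext t
  simp only [evalAt_apply, arrayEntry_spectralWord, mul_assoc, ← Finset.mul_sum, ← mul_pow,
    ← root_add hω]
  split_ifs with h
  · subst h
    simp [root_zero, natCast_eight]
  · rw [sum_root_pow hω, mul_zero, Pi.zero_apply]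
    intro h0
    exact h (neg_add_eq_zero.1 h0).symm

/-- The discrete Fourier transform of words of length `8 * 2`. -/
noncomputable def spectrum8 (ω : F) : (Fin (8 * 2) → F) →ₗ[F] (ZMod 8 → Fin 2 → F) :=
  LinearMap.pi fun j => evalAt 8 2 (root ω j)

theorem spectrum8_apply (c : Fin (8 * 2) → F) (j : ZMod 8) :
    spectrum8 ω c j = evalAt 8 2 (root ω j) c := rfl

theorem spectrum8_sum_spectralWord [CharP F 3] (hω : orderOf ω = 8) (w : ZMod 8 → Fin 2 → F) :
    spectrum8 ω (-∑ j, spectralWord ω j (w j)) = w := by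
  funext i
  rw [spectrum8_apply, map_neg, map_sum]
  simp [evalAt_spectralWord hω]

theorem spectrum8_bijective [CharP F 3] (hω : orderOf ω = 8) :
    Function.Bijective (spectrum8 ω) := by
  have hs : Function.Surjective (spectrum8 ω) := fun w => ⟨_, spectrum8_sum_spectralWord hω w⟩
  refine ⟨(LinearMap.injective_iff_surjective_of_finrank_eq_finrank ?_).2 hs, hs⟩
  rw [Module.finrank_fintype_fun_eq_card, Module.finrank_pi_fintype]
  simp

/-- The inversion formula of the discrete Fourier transform. -/
theorem eq_neg_sum_spectralWord [CharP F 3] (hω : orderOf ω = 8) (c : Fin (8 * 2) → F) :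
    c = -∑ j, spectralWord ω j (evalAt 8 2 (root ω j) c) :=
  (spectrum8_bijective hω).1 (spectrum8_sum_spectralWord hω _).symm

/-- The code of all words whose evaluation at `root ω j` lies in `K j`, for all `j`. -/
noncomputable def spectralCode (ω : F) (K : ZMod 8 → Submodule F (Fin 2 → F)) :
    Submodule F (Fin (8 * 2) → F) := (Submodule.pi Set.univ K).comap (spectrum8 ω)

theorem mem_spectralCode {K : ZMod 8 → Submodule F (Fin 2 → F)} {c : Fin (8 * 2) → F} :
    c ∈ spectralCode ω K ↔ ∀ j, evalAt 8 2 (root ω j) c ∈ K j :=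
  ⟨fun h j => h j trivial, fun h j _ => h j⟩

theorem spectralWord_mem_spectralCode [CharP F 3] (hω : orderOf ω = 8)
    {K : ZMod 8 → Submodule F (Fin 2 → F)} {j : ZMod 8} {w : Fin 2 → F} (hw : w ∈ K j) :
    spectralWord ω j w ∈ spectralCode ω K := by
  rw [mem_spectralCode]
  intro i
  rw [evalAt_spectralWord hω]
  split_ifs with h
  · exact (K i).neg_mem (h ▸ hw)
  · exact (K i).zero_mem

theorem spectralCode_inf (K K' : ZMod 8 → Submodule F (Fin 2 → F)) :
    spectralCode ω K ⊓ spectralCode ω K' = spectralCode ω (K ⊓ K') := by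
  ext c
  simp only [Submodule.mem_inf, mem_spectralCode, Pi.inf_apply, forall_and]

theorem spectralCode_sup [CharP F 3] (hω : orderOf ω = 8)
    (K K' : ZMod 8 → Submodule F (Fin 2 → F)) :
    spectralCode ω K ⊔ spectralCode ω K' = spectralCode ω (K ⊔ K') := by
  refine le_antisymm (sup_le (fun c hc => ?_) (fun c hc => ?_)) (fun c hc => ?_)
  · exact mem_spectralCode.2 fun j => Submodule.mem_sup_left (mem_spectralCode.1 hc j)
  · exact mem_spectralCode.2 fun j => Submodule.mem_sup_right (mem_spectralCode.1 hc j)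
  · have h := fun j => Submodule.mem_sup.1 (mem_spectralCode.1 hc j)
    choose x hx y hy hxy using h
    refine Submodule.mem_sup.2 ⟨-∑ j, spectralWord ω j (x j), ?_, -∑ j, spectralWord ω j (y j), ?_,
      ?_⟩
    · exact Submodule.neg_mem _ (Submodule.sum_mem _ fun j _ =>
        spectralWord_mem_spectralCode hω (hx j))
    · exact Submodule.neg_mem _ (Submodule.sum_mem _ fun j _ =>
        spectralWord_mem_spectralCode hω (hy j))
    · apply (spectrum8_bijective hω).1
      rw [map_add, spectrum8_sum_spectralWord hω, spectrum8_sum_spectralWord hω]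
      exact funext hxy

theorem finrank_spectralCode [CharP F 3] (hω : orderOf ω = 8)
    (K : ZMod 8 → Submodule F (Fin 2 → F)) :
    Module.finrank F (spectralCode ω K) = ∑ j, Module.finrank F (K j) := by
  rw [← Module.finrank_pi_fintype]
  let f : spectralCode ω K →ₗ[F] ∀ j, K j := LinearMap.pi fun j =>
    ((evalAt 8 2 (root ω j)).comp (spectralCode ω K).subtype).codRestrict (K j)
      fun c => mem_spectralCode.1 c.2 j
  refine (LinearEquiv.ofBijective f ⟨?_, ?_⟩).finrank_eq
  · intro c d hcd
    apply Subtype.ext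
    apply (spectrum8_bijective hω).1
    funext j
    exact congrArg (fun x => (x j : Fin 2 → F)) hcd
  · intro w
    have h := spectrum8_sum_spectralWord hω fun j => (w j : Fin 2 → F)
    refine ⟨⟨-∑ j, spectralWord ω j (w j), mem_spectralCode.2 fun j => ?_⟩, ?_⟩
    · rw [← spectrum8_apply, h]; exact (w j).2
    · funext j
      exact Subtype.ext (congrFun h j)

theorem constituent_spectralCode [CharP F 3] (hω : orderOf ω = 8)
    (K : ZMod 8 → Submodule F (Fin 2 → F)) (j : ZMod 8) :
    constituent 8 2 (spectralCode ω K) (root ω j) = K j := by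
  refine le_antisymm ?_ fun w hw => ?_
  · rintro _ ⟨c, hc, rfl⟩
    exact mem_spectralCode.1 hc j
  · refine ⟨-spectralWord ω j w, Submodule.neg_mem _ (spectralWord_mem_spectralCode hω hw), ?_⟩
    rw [map_neg, evalAt_spectralWord hω, if_pos rfl, neg_neg]

theorem sum_mul_spectralWord_pow_three (hω : orderOf ω = 8) (v : Fin (8 * 2) → F) (j : ZMod 8)
    (w : Fin 2 → F) :
    ∑ i, v i * spectralWord ω j w i ^ 3 = ∑ t, evalAt 8 2 (root ω (-3 * j)) v t * w t ^ 3 := by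
  rw [sum_eq_sum_arrayEntry]
  refine Finset.sum_congr rfl fun t _ => ?_
  rw [evalAt_apply, Finset.sum_mul]
  refine Finset.sum_congr rfl fun g _ => ?_
  change arrayEntry v g t * arrayEntry (spectralWord ω j w) g t ^ 3 = _
  rw [arrayEntry_spectralWord, show -3 * j = ((3 : ℕ) : ZMod 8) * -j by push_cast; ring,
    root_natCast_mul hω]
  ring

/-- Parseval's identity for the Hermitian form. -/
theorem sum_mul_pow_three [CharP F 3] (hω : orderOf ω = 8) (v c : Fin (8 * 2) → F) :
    ∑ i, v i * c i ^ 3 = -∑ j, ∑ t, evalAt 8 2 (root ω (-3 * j)) v t *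
      evalAt 8 2 (root ω j) c t ^ 3 := by
  conv_lhs => rw [eq_neg_sum_spectralWord hω c]
  simp only [← sum_mul_spectralWord_pow_three hω]
  rw [Finset.sum_comm, eq_neg_iff_add_eq_zero, ← Finset.sum_add_distrib]
  refine Finset.sum_eq_zero fun i _ => ?_
  rw [← Finset.mul_sum, ← sum_pow_three Finset.univ, Pi.neg_apply, Finset.sum_apply]
  ring

/-- The Hermitian dual of a spectral code; note that `-3` is its own inverse modulo `8`. -/
theorem hermitianDual_spectralCode [CharP F 3] (hω : orderOf ω = 8)
    (K : ZMod 8 → Submodule F (Fin 2 → F)) :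
    hermitianDual 3 (spectralCode ω K) = spectralCode ω fun i => hermitianDual 3 (K (-3 * i)) := by
  have h9 : ∀ j : ZMod 8, -3 * (-3 * j) = j := by decide
  ext v
  rw [mem_spectralCode]
  constructor
  · intro hv i w hw
    have h := hv _ (spectralWord_mem_spectralCode hω hw)
    rwa [sum_mul_spectralWord_pow_three hω, h9] at h
  · intro hv c hc
    rw [sum_mul_pow_three hω, neg_eq_zero]
    refine Finset.sum_eq_zero fun j _ => ?_
    have h := hv (-3 * j)
    rw [h9] at h
    exact h _ (mem_spectralCode.1 hc j)

theorem arrayEntry_cyclicShift_two {F : Type*} (c : Fin (8 * 2) → F) (g : Fin 8) (t : Fin 2) :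
    arrayEntry (cyclicShift 2 c) g t = arrayEntry c (g - 1) t := by
  have h : ∀ (g : Fin 8) (t : Fin 2), ((finRotate (8 * 2)) ^ 2).symm (finProdFinEquiv (g, t)) =
      finProdFinEquiv (g - 1, t) := by
    intro g t
    rw [Equiv.symm_apply_eq]
    revert g t
    decide
  rw [arrayEntry, cyclicShift, h, arrayEntry]

theorem arrayEntry_cyclicShift_one {F : Type*} (c : Fin (8 * 2) → F) (g : Fin 8) :
    arrayEntry (cyclicShift 1 c) g 0 = arrayEntry c (g - 1) 1 ∧
      arrayEntry (cyclicShift 1 c) g 1 = arrayEntry c g 0 := by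
  have h : ∀ g : Fin 8, ((finRotate (8 * 2)) ^ 1).symm (finProdFinEquiv (g, (0 : Fin 2))) =
      finProdFinEquiv (g - 1, (1 : Fin 2)) ∧
      ((finRotate (8 * 2)) ^ 1).symm (finProdFinEquiv (g, (1 : Fin 2))) =
      finProdFinEquiv (g, (0 : Fin 2)) := by
    intro g
    rw [Equiv.symm_apply_eq, Equiv.symm_apply_eq]
    revert g
    decide
  simp only [arrayEntry, cyclicShift, h, and_self]

theorem sum_sub_one_mul_pow {R : Type*} [CommRing R] (f : Fin 8 → R) {a : R} (ha : a ^ 8 = 1) :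
    ∑ g, f (g - 1) * a ^ (g : ℕ) = a * ∑ g, f g * a ^ (g : ℕ) := by
  rw [← Equiv.sum_comp (Equiv.addRight (1 : Fin 8)), Finset.mul_sum]
  refine Finset.sum_congr rfl fun g _ => ?_
  have h : a ^ ((g + 1 : Fin 8) : ℕ) = a ^ ((g : ℕ) + 1) := by
    rw [Fin.val_add, show ((1 : Fin 8) : ℕ) = 1 from rfl]
    conv_rhs => rw [← Nat.div_add_mod ((g : ℕ) + 1) 8, pow_add, pow_mul, ha, one_pow, one_mul]
  rw [Equiv.coe_addRight, add_sub_cancel_right, h]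
  ring

theorem evalAt_cyclicShift_two (c : Fin (8 * 2) → F) {a : F} (ha : a ^ 8 = 1) :
    evalAt 8 2 a (cyclicShift 2 c) = a • evalAt 8 2 a c := by
  funext t
  simp only [evalAt_apply, arrayEntry_cyclicShift_two, Pi.smul_apply, smul_eq_mul]
  exact sum_sub_one_mul_pow (fun g => arrayEntry c g t) ha

theorem evalAt_cyclicShift_one (c : Fin (8 * 2) → F) {a : F} (ha : a ^ 8 = 1) :
    evalAt 8 2 a (cyclicShift 1 c) = ![a * evalAt 8 2 a c 1, evalAt 8 2 a c 0] := by
  funext t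
  fin_cases t
  · simp only [Fin.zero_eta, evalAt_apply, arrayEntry_cyclicShift_one]
    exact sum_sub_one_mul_pow (fun g => arrayEntry c g 1) ha
  · simp only [Fin.mk_one, evalAt_apply, arrayEntry_cyclicShift_one]
    rfl

theorem cyclicShift_two_mem_spectralCode (hω : orderOf ω = 8)
    {K : ZMod 8 → Submodule F (Fin 2 → F)} {c : Fin (8 * 2) → F} (hc : c ∈ spectralCode ω K) :
    cyclicShift 2 c ∈ spectralCode ω K := by
  rw [mem_spectralCode] at hc ⊢
  intro j
  rw [evalAt_cyclicShift_two c (root_pow_eight hω j)]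
  exact (K j).smul_mem _ (hc j)

/-- A code that is invariant under the shift by two positions contains, with a word, the
projections of this word to all frequencies. -/
theorem spectralWord_evalAt_mem [CharP F 3] (hω : orderOf ω = 8)
    {D : Submodule F (Fin (8 * 2) → F)} (hD : ∀ c ∈ D, cyclicShift 2 c ∈ D)
    {c : Fin (8 * 2) → F} (hc : c ∈ D) (j : ZMod 8) :
    spectralWord ω j (evalAt 8 2 (root ω j) c) ∈ D := by
  have hit : ∀ k : ℕ, (cyclicShift 2)^[k] c ∈ D := by
    intro k
    induction k with
    | zero => exact hc
    | succ k ih => rw [Function.iterate_succ_apply']; exact hD _ ih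
  have hev : ∀ (i : ZMod 8) (k : ℕ), evalAt 8 2 (root ω i) ((cyclicShift 2)^[k] c) =
      root ω i ^ k • evalAt 8 2 (root ω i) c := by
    intro i k
    induction k with
    | zero => simp
    | succ k ih =>
      rw [Function.iterate_succ_apply', evalAt_cyclicShift_two _ (root_pow_eight hω i), ih,
        smul_smul, pow_succ']
  have key : spectralWord ω j (evalAt 8 2 (root ω j) c) =
      ∑ k : Fin 8, root ω (-j) ^ (k : ℕ) • (cyclicShift 2)^[(k : ℕ)] c := by
    apply (spectrum8_bijective hω).1
    funext i
    simp only [spectrum8_apply, map_sum, map_smul, hev, smul_smul, ← mul_pow, ← root_add hω,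
      ← Finset.sum_smul]
    rw [evalAt_spectralWord hω]
    split_ifs with h
    · subst h
      simp [root_zero, natCast_eight]
    · rw [sum_root_pow hω, zero_smul]
      intro h0
      exact h (neg_add_eq_zero.1 h0).symm
  rw [key]
  exact Submodule.sum_mem _ fun k _ => Submodule.smul_mem _ _ (hit k)

/-- A code that is invariant under the shift by two positions is determined by its constituents. -/
theorem eq_spectralCode_constituent [CharP F 3] (hω : orderOf ω = 8)
    {D : Submodule F (Fin (8 * 2) → F)} (hD : ∀ c ∈ D, cyclicShift 2 c ∈ D) :
    D = spectralCode ω fun j => constituent 8 2 D (root ω j) := by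
  refine le_antisymm (fun c hc => ?_) fun c hc => ?_
  · exact mem_spectralCode.2 fun j => Submodule.mem_map_of_mem hc
  rw [eq_neg_sum_spectralWord hω c]
  refine Submodule.neg_mem _ (Submodule.sum_mem _ fun j _ => ?_)
  obtain ⟨d, hd, hdc⟩ := mem_spectralCode.1 hc j
  rw [← hdc]
  exact spectralWord_evalAt_mem hω hD hd j

end SpectralCodes

/-! ### Weights of spectral codes -/

section Weights

variable {F : Type*} [Field F] {ω : F}

/-- The BCH bound: a nonzero word whose generating polynomial vanishes at `m` consecutive powers of
`ω` has weight greater than `m`. -/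
theorem eq_zero_of_hammingNorm_le [DecidableEq F] (hω : orderOf ω = 8) {m : ℕ} {v : Fin 8 → F}
    (hv : ∀ r, 1 ≤ r → r ≤ m → ∑ g, v g * (ω ^ r) ^ (g : ℕ) = 0) (hm : hammingNorm v ≤ m) :
    v = 0 := by
  have hω0 : ω ≠ 0 := by
    rintro rfl
    simp [orderOf_zero] at hω
  let s : Finset (Fin 8) := Finset.univ.filter fun g => v g ≠ 0
  have hs : s.card ≤ m := hm
  let e : Fin s.card ≃ s := s.equivFin.symm
  have hinj : Function.Injective fun i => ω ^ ((e i : Fin 8) : ℕ) := by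
    intro i j hij
    have h1 := pow_injOn_Iio_orderOf (x := ω) (by rw [hω]; exact (e i : Fin 8).2)
      (by rw [hω]; exact (e j : Fin 8).2) hij
    exact e.injective (Subtype.ext (Fin.ext h1))
  have hzero := Matrix.eq_zero_of_forall_pow_sum_mul_pow_eq_zero hinj
    (v := fun i => v (e i) * ω ^ ((e i : Fin 8) : ℕ)) (fun r => by
      have h := hv (r + 1) (by omega) (by omega)
      rw [← h, Equiv.sum_comp e (fun x : s => v x * ω ^ ((x : Fin 8) : ℕ) *
        (ω ^ ((x : Fin 8) : ℕ)) ^ (r : ℕ)), Finset.sum_coe_sort s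
        (fun x => v x * ω ^ (x : ℕ) * (ω ^ (x : ℕ)) ^ (r : ℕ)), Finset.sum_filter]
      refine Finset.sum_congr rfl fun g _ => ?_
      split_ifs with hg
      · ring
      · rw [not_not.1 hg, zero_mul])
  funext g
  by_contra hg
  have h := congrFun hzero (e.symm ⟨g, by simpa [s] using hg⟩)
  simp only [Equiv.apply_symm_apply, Pi.zero_apply] at h
  exact (mul_ne_zero hg (pow_ne_zero _ hω0)) h

/-- The column `t` of the array of a word. -/
def column {F : Type*} (c : Fin (8 * 2) → F) (t : Fin 2) : Fin 8 → F := fun g => arrayEntry c g t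

theorem hammingNorm_eq_add [DecidableEq F] (c : Fin (8 * 2) → F) :
    hammingNorm c = hammingNorm (column c 0) + hammingNorm (column c 1) := by
  simp only [hammingNorm, Finset.card_filter]
  rw [← Equiv.sum_comp finProdFinEquiv, Fintype.sum_prod_type_right, Fin.sum_univ_two]
  rfl

theorem eq_zero_of_column_eq_zero {c : Fin (8 * 2) → F} (h0 : column c 0 = 0)
    (h1 : column c 1 = 0) : c = 0 := by
  refine arrayEntry_ext fun g t => ?_
  fin_cases t
  · exact congrFun h0 g
  · exact congrFun h1 g

theorem evalAt_eq_sum_column (c : Fin (8 * 2) → F) (a : F) (t : Fin 2) :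
    evalAt 8 2 a c t = ∑ g, column c t g * a ^ (g : ℕ) := evalAt_apply a c t

/-- The code spanned by `(1, s)`. -/
def line (s : F) : Submodule F (Fin 2 → F) := Submodule.span F {![1, s]}

theorem mem_line {s : F} {w : Fin 2 → F} : w ∈ line s ↔ w 1 = s * w 0 := by
  rw [line, Submodule.mem_span_singleton]
  constructor
  · rintro ⟨a, rfl⟩
    simp [mul_comm]
  · intro h
    refine ⟨w 0, ?_⟩
    funext t
    fin_cases t
    · simp
    · simp [h, mul_comm]

/-- The values at `ω ^ 2` and `ω ^ 4` of a word of weight two that vanishes at `ω`; in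
characteristic three `x ^ 3 - y ^ 3 = (x - y) ^ 3`. -/
theorem exists_eval_of_hammingNorm_eq_two [DecidableEq F] [CharP F 3] (hω : orderOf ω = 8) {v : Fin 8 → F}
    (hv : hammingNorm v = 2) (h1 : ∑ g, v g * ω ^ (g : ℕ) = 0) :
    ∃ a z : F, a ≠ 0 ∧ z ≠ 0 ∧ ∑ g, v g * (ω ^ 2) ^ (g : ℕ) = a ∧
      ∑ g, v g * (ω ^ 4) ^ (g : ℕ) = a * z ^ 2 := by
  have hω0 : ω ≠ 0 := by
    rintro rfl
    simp [orderOf_zero] at hω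
  obtain ⟨i, j, hij, hs⟩ := Finset.card_eq_two.1 hv
  have hsupp : ∀ g, v g ≠ 0 ↔ g = i ∨ g = j := by
    intro g
    have : g ∈ Finset.univ.filter (fun g => v g ≠ 0) ↔ g ∈ ({i, j} : Finset (Fin 8)) := by rw [hs]
    simpa using this
  have hsum : ∀ a : F, ∑ g, v g * a ^ (g : ℕ) = v i * a ^ (i : ℕ) + v j * a ^ (j : ℕ) := by
    intro a
    rw [← Finset.sum_pair (f := fun g => v g * a ^ (g : ℕ)) hij]
    symm
    refine Finset.sum_subset (Finset.subset_univ _) fun g _ hg => ?_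
    have : v g = 0 := by
      by_contra h
      have := (hsupp g).1 h
      simp at hg
      tauto
    rw [this, zero_mul]
  have hvi : v i ≠ 0 := (hsupp i).2 (Or.inl rfl)
  have hxy : ω ^ (i : ℕ) - ω ^ (j : ℕ) ≠ 0 := by
    intro h
    have h1 := pow_injOn_Iio_orderOf (x := ω) (by rw [hω]; exact i.2) (by rw [hω]; exact j.2)
      (sub_eq_zero.1 h)
    exact hij (Fin.ext h1)
  simp only [hsum] at h1 ⊢
  have h3 : (3 : F) = 0 := by exact_mod_cast CharP.cast_eq_zero F 3
  refine ⟨_, ω ^ (i : ℕ) - ω ^ (j : ℕ), ?_, hxy, rfl, ?_⟩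
  · have : v i * (ω ^ 2) ^ (i : ℕ) + v j * (ω ^ 2) ^ (j : ℕ) =
        v i * ω ^ (i : ℕ) * (ω ^ (i : ℕ) - ω ^ (j : ℕ)) := by
      rw [pow_right_comm ω 2, pow_right_comm ω 2]
      linear_combination ω ^ (j : ℕ) * h1
    rw [this]
    exact mul_ne_zero (mul_ne_zero hvi (pow_ne_zero _ hω0)) hxy
  · rw [pow_right_comm ω 2, pow_right_comm ω 2, pow_right_comm ω 4, pow_right_comm ω 4]
    generalize ω ^ (i : ℕ) = x at *
    generalize ω ^ (j : ℕ) = y at *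
    linear_combination (2 * x ^ 2 * y - x * y ^ 2) * h1 + (x * y ^ 3 - x ^ 2 * y ^ 2) * v j * h3

/-- The minimum distance of the relevant spectral codes. If one of the columns vanishes, the BCH
bound applies to the other one. Otherwise both columns have weight at least two, since both vanish
at `ω`; and if both had weight two, then the conditions at `ω ^ 2` and `ω ^ 4` would show that
`ω` is a square. -/
theorem le_hammingNorm [DecidableEq F] [Fintype F] [CharP F 3] (hF : Fintype.card F = 9) (hω : orderOf ω = 8) {c : Fin (8 * 2) → F} (hc : c ≠ 0)
    (h1 : evalAt 8 2 ω c = 0) (h2 : evalAt 8 2 (ω ^ 2) c ∈ line (ω ^ 7))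
    (h3 : evalAt 8 2 (ω ^ 3) c ∈ line (ω ^ 2)) :
    4 ≤ hammingNorm c ∧ (evalAt 8 2 (ω ^ 4) c ∈ line (ω ^ 6) → 5 ≤ hammingNorm c) := by
  have hω0 : ω ≠ 0 := by
    rintro rfl
    simp [orderOf_zero] at hω
  rw [hammingNorm_eq_add]
  rw [mem_line] at h2 h3
  rw [mem_line]
  have h1' : ∀ t, evalAt 8 2 ω c t = 0 := fun t => congrFun h1 t
  simp only [evalAt_eq_sum_column] at h1' h2 h3 ⊢
  by_cases c0 : column c 0 = 0
  · have c1 : column c 1 ≠ 0 := fun c1 => hc (eq_zero_of_column_eq_zero c0 c1)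
    simp only [c0, Pi.zero_apply, zero_mul, Finset.sum_const_zero, mul_zero] at h2 h3 ⊢
    constructor
    · by_contra! hlt
      refine c1 (eq_zero_of_hammingNorm_le hω (m := 3) (fun r hr hr' => ?_) (by omega))
      interval_cases r
      exacts [by simpa using h1' 1, h2, h3]
    · intro h4
      by_contra! hlt
      refine c1 (eq_zero_of_hammingNorm_le hω (m := 4) (fun r hr hr' => ?_) (by omega))
      interval_cases r
      exacts [by simpa using h1' 1, h2, h3, h4]
  by_cases c1 : column c 1 = 0
  · have hcancel : ∀ {k : ℕ} {x : F}, 0 = ω ^ k * x → x = 0 := fun {k x} h =>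
      (mul_eq_zero.1 h.symm).resolve_left (pow_ne_zero _ hω0)
    simp only [c1, Pi.zero_apply, zero_mul, Finset.sum_const_zero] at h2 h3 ⊢
    constructor
    · by_contra! hlt
      refine c0 (eq_zero_of_hammingNorm_le hω (m := 3) (fun r hr hr' => ?_) (by omega))
      interval_cases r
      exacts [by simpa using h1' 0, hcancel h2, hcancel h3]
    · intro h4
      by_contra! hlt
      refine c0 (eq_zero_of_hammingNorm_le hω (m := 4) (fun r hr hr' => ?_) (by omega))
      interval_cases r
      exacts [by simpa using h1' 0, hcancel h2, hcancel h3, hcancel h4]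
  have hge : ∀ t, column c t ≠ 0 → 2 ≤ hammingNorm (column c t) := by
    intro t ht
    by_contra! hlt
    refine ht (eq_zero_of_hammingNorm_le hω (m := 1) (fun r hr hr' => ?_) (by omega))
    interval_cases r
    simpa using h1' t
  have g0 := hge 0 c0
  have g1 := hge 1 c1
  refine ⟨by omega, fun h4 => ?_⟩
  by_contra! hlt
  obtain ⟨a, x, ha, hx, e2, e4⟩ := exists_eval_of_hammingNorm_eq_two hω
    (v := column c 0) (by omega) (h1' 0)
  obtain ⟨b, y, hb, hy, f2, f4⟩ := exists_eval_of_hammingNorm_eq_two hω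
    (v := column c 1) (by omega) (h1' 1)
  rw [e2, f2] at h2
  rw [e4, f4, h2] at h4
  have hsq : ω * y ^ 2 = x ^ 2 := by
    have : ω ^ 6 * a ≠ 0 := mul_ne_zero (pow_ne_zero _ hω0) ha
    apply mul_left_cancel₀ this
    linear_combination h4
  -- `ω` would be a square, so that its order would divide `4`
  have hcard : ∀ z : F, z ≠ 0 → z ^ 8 = 1 := fun z hz => by
    simpa [hF] using FiniteField.pow_card_sub_one_eq_one z hz
  have h4' : ω ^ 4 = 1 := by
    have := congrArg (· ^ 4) hsq
    simp only [mul_pow, ← pow_mul] at this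
    simpa [hcard x hx, hcard y hy] using this
  have := orderOf_dvd_of_pow_eq_one h4'
  rw [hω] at this
  omega

end Weights

/-! ### The quasi-cyclic code -/

section QutritExample

variable {F : Type*} [Field F] {ω : F}

theorem forall_zmod_eight {P : ZMod 8 → Prop} (h0 : P 0) (h1 : P 1) (h2 : P 2) (h3 : P 3)
    (h4 : P 4) (h5 : P 5) (h6 : P 6) (h7 : P 7) : ∀ j, P j := by
  intro j
  fin_cases j
  exacts [h0, h1, h2, h3, h4, h5, h6, h7]

theorem line_inf {s s' : F} (h : s ≠ s') : line s ⊓ line s' = ⊥ := by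
  rw [eq_bot_iff]
  rintro w ⟨h1, h2⟩
  rw [SetLike.mem_coe, mem_line] at h1 h2
  have h0 : w 0 = 0 := by
    have : (s - s') * w 0 = 0 := by rw [sub_mul, ← h1, ← h2, sub_self]
    exact (mul_eq_zero.1 this).resolve_left (sub_ne_zero.2 h)
  rw [h0, mul_zero] at h1
  exact funext fun t => by fin_cases t <;> simp [h0, h1]

theorem finrank_line (s : F) : Module.finrank F (line s) = 1 :=
  finrank_span_singleton fun h => one_ne_zero (congrFun h 0)

theorem line_sup {s s' : F} (h : s ≠ s') : line s ⊔ line s' = ⊤ := by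
  apply Submodule.eq_top_of_finrank_eq
  have h1 := Submodule.finrank_sup_add_finrank_inf_eq (line s) (line s')
  rw [line_inf h, finrank_bot, finrank_line, finrank_line] at h1
  rw [Module.finrank_fin_fun]
  exact h1

theorem hermitianDual_bot {q n : ℕ} (hq : q ≠ 0) :
    hermitianDual q (⊥ : Submodule F (Fin n → F)) = ⊤ := by
  refine eq_top_iff.2 fun v _ u hu => ?_
  rw [Submodule.mem_bot] at hu
  simp [hu, hq]

theorem hermitianDual_top {q n : ℕ} (hq : q ≠ 0) :
    hermitianDual q (⊤ : Submodule F (Fin n → F)) = ⊥ := by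
  refine eq_bot_iff.2 fun v hv => funext fun i => ?_
  have h := hv (Pi.single i 1) trivial
  rw [Finset.sum_eq_single i] at h
  · simpa using h
  · intro j _ hj
    simp [hj, hq]
  · simp

theorem hermitianDual_line {s s' : F} (h : s' * s ^ 3 = -1) :
    hermitianDual 3 (line s) = line s' := by
  ext w
  rw [mem_line]
  constructor
  · intro hw
    have h1 := hw ![1, s] (mem_line.2 (by simp))
    rw [Fin.sum_univ_two] at h1
    simp only [Matrix.cons_val_zero, Matrix.cons_val_one, one_pow, mul_one] at h1
    linear_combination w 1 * h - s' * h1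
  · intro hw u hu
    rw [mem_line] at hu
    rw [Fin.sum_univ_two, hw, hu]
    linear_combination w 0 * u 0 ^ 3 * h

/-- The constituents of the code; the index `j` stands for the root `ω ^ j`. -/
def codeFamily (ω : F) : ZMod 8 → Submodule F (Fin 2 → F) :=
  ![⊥, ⊥, line (ω ^ 7), ⊥, line (ω ^ 2), ⊤, ⊥, line (ω ^ 6)]

/-- The constituents of the Hermitian dual. -/
def dualFamily (ω : F) : ZMod 8 → Submodule F (Fin 2 → F) :=
  ![⊤, ⊥, line (ω ^ 7), line (ω ^ 2), line (ω ^ 6), ⊤, ⊤, ⊤]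

/-- The constituents of the intersection of the code with its Hermitian dual. -/
def hullFamily (ω : F) : ZMod 8 → Submodule F (Fin 2 → F) :=
  ![⊥, ⊥, line (ω ^ 7), ⊥, ⊥, ⊤, ⊥, line (ω ^ 6)]

/-- The constituents of the sum of the code and its Hermitian dual. -/
def sumFamily (ω : F) : ZMod 8 → Submodule F (Fin 2 → F) :=
  ![⊤, ⊥, line (ω ^ 7), line (ω ^ 2), ⊤, ⊤, ⊤, ⊤]

theorem codeFamily_apply (ω : F) :
    codeFamily ω 0 = ⊥ ∧ codeFamily ω 1 = ⊥ ∧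
    codeFamily ω 2 = line (ω ^ 7) ∧ codeFamily ω 3 = ⊥ ∧
    codeFamily ω 4 = line (ω ^ 2) ∧ codeFamily ω 5 = ⊤ ∧
    codeFamily ω 6 = ⊥ ∧ codeFamily ω 7 = line (ω ^ 6) :=
  ⟨rfl, rfl, rfl, rfl, rfl, rfl, rfl, rfl⟩

theorem dualFamily_apply (ω : F) :
    dualFamily ω 0 = ⊤ ∧ dualFamily ω 1 = ⊥ ∧
    dualFamily ω 2 = line (ω ^ 7) ∧ dualFamily ω 3 = line (ω ^ 2) ∧
    dualFamily ω 4 = line (ω ^ 6) ∧ dualFamily ω 5 = ⊤ ∧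
    dualFamily ω 6 = ⊤ ∧ dualFamily ω 7 = ⊤ :=
  ⟨rfl, rfl, rfl, rfl, rfl, rfl, rfl, rfl⟩

theorem hullFamily_apply (ω : F) :
    hullFamily ω 0 = ⊥ ∧ hullFamily ω 1 = ⊥ ∧
    hullFamily ω 2 = line (ω ^ 7) ∧ hullFamily ω 3 = ⊥ ∧
    hullFamily ω 4 = ⊥ ∧ hullFamily ω 5 = ⊤ ∧
    hullFamily ω 6 = ⊥ ∧ hullFamily ω 7 = line (ω ^ 6) :=
  ⟨rfl, rfl, rfl, rfl, rfl, rfl, rfl, rfl⟩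

theorem sumFamily_apply (ω : F) :
    sumFamily ω 0 = ⊤ ∧ sumFamily ω 1 = ⊥ ∧
    sumFamily ω 2 = line (ω ^ 7) ∧ sumFamily ω 3 = line (ω ^ 2) ∧
    sumFamily ω 4 = ⊤ ∧ sumFamily ω 5 = ⊤ ∧
    sumFamily ω 6 = ⊤ ∧ sumFamily ω 7 = ⊤ :=
  ⟨rfl, rfl, rfl, rfl, rfl, rfl, rfl, rfl⟩

theorem pow_four_eq (hω : orderOf ω = 8) : ω ^ 4 = -1 := by
  have h8 : ω ^ 8 = 1 := hω ▸ pow_orderOf_eq_one ω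
  have h : (ω ^ 4 - 1) * (ω ^ 4 + 1) = 0 := by linear_combination h8
  rcases mul_eq_zero.1 h with h | h
  · have := orderOf_dvd_of_pow_eq_one (sub_eq_zero.1 h)
    rw [hω] at this
    omega
  · exact eq_neg_of_add_eq_zero_left h

theorem pow_ne_pow (hω : orderOf ω = 8) {a b : ℕ} (ha : a < 8) (hb : b < 8) (hab : a ≠ b) :
    ω ^ a ≠ ω ^ b := fun h =>
  hab (pow_injOn_Iio_orderOf (x := ω) (by rwa [hω]) (by rwa [hω]) h)

theorem hermitianDual_codeFamily (hω : orderOf ω = 8) :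
    (fun i => hermitianDual 3 (codeFamily ω (-3 * i))) = dualFamily ω := by
  have h4 := pow_four_eq hω
  funext i
  revert i
  refine forall_zmod_eight (hermitianDual_bot three_ne_zero) (hermitianDual_top three_ne_zero)
    (hermitianDual_line ?_) (hermitianDual_line ?_) (hermitianDual_line ?_)
    (hermitianDual_bot three_ne_zero) (hermitianDual_bot three_ne_zero)
    (hermitianDual_bot three_ne_zero)
  · linear_combination (ω ^ 24 - ω ^ 20 + ω ^ 16 - ω ^ 12 + ω ^ 8 - ω ^ 4 + 1) * h4
  · linear_combination (ω ^ 16 - ω ^ 12 + ω ^ 8 - ω ^ 4 + 1) * h4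
  · linear_combination (ω ^ 8 - ω ^ 4 + 1) * h4

theorem hermitianDual_hullFamily (hω : orderOf ω = 8) :
    (fun i => hermitianDual 3 (hullFamily ω (-3 * i))) = sumFamily ω := by
  have h4 := pow_four_eq hω
  funext i
  revert i
  refine forall_zmod_eight (hermitianDual_bot three_ne_zero) (hermitianDual_top three_ne_zero)
    (hermitianDual_line ?_) (hermitianDual_line ?_) (hermitianDual_bot three_ne_zero)
    (hermitianDual_bot three_ne_zero) (hermitianDual_bot three_ne_zero)
    (hermitianDual_bot three_ne_zero)
  · linear_combination (ω ^ 24 - ω ^ 20 + ω ^ 16 - ω ^ 12 + ω ^ 8 - ω ^ 4 + 1) * h4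
  · linear_combination (ω ^ 16 - ω ^ 12 + ω ^ 8 - ω ^ 4 + 1) * h4

theorem codeFamily_inf_dualFamily (hω : orderOf ω = 8) :
    codeFamily ω ⊓ dualFamily ω = hullFamily ω := by
  have h := line_inf (pow_ne_pow hω (a := 2) (b := 6) (by norm_num) (by norm_num) (by norm_num))
  funext i
  rw [Pi.inf_apply]
  revert i
  apply forall_zmod_eight <;>
    simp only [codeFamily_apply, dualFamily_apply, hullFamily_apply, bot_inf_eq, inf_idem,
      inf_top_eq, h]

theorem codeFamily_sup_dualFamily (hω : orderOf ω = 8) :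
    codeFamily ω ⊔ dualFamily ω = sumFamily ω := by
  have h := line_sup (pow_ne_pow hω (a := 2) (b := 6) (by norm_num) (by norm_num) (by norm_num))
  funext i
  rw [Pi.sup_apply]
  revert i
  apply forall_zmod_eight <;>
    simp only [codeFamily_apply, dualFamily_apply, sumFamily_apply, bot_sup_eq, sup_idem,
      sup_top_eq, h]

theorem sum_zmod_eight (f : ZMod 8 → ℕ) :
    ∑ j, f j = f 0 + f 1 + f 2 + f 3 + f 4 + f 5 + f 6 + f 7 :=
  Fin.sum_univ_eight f

theorem finrank_codeFamily (ω : F) : ∑ j, Module.finrank F (codeFamily ω j) = 5 := by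
  obtain ⟨h0, h1, h2, h3, h4, h5, h6, h7⟩ := codeFamily_apply ω
  rw [sum_zmod_eight, h0, h1, h2, h3, h4, h5, h6, h7]
  simp [finrank_line]

theorem finrank_dualFamily (ω : F) : ∑ j, Module.finrank F (dualFamily ω j) = 11 := by
  obtain ⟨h0, h1, h2, h3, h4, h5, h6, h7⟩ := dualFamily_apply ω
  rw [sum_zmod_eight, h0, h1, h2, h3, h4, h5, h6, h7]
  simp [finrank_line]

theorem finrank_hullFamily (ω : F) : ∑ j, Module.finrank F (hullFamily ω j) = 4 := by
  obtain ⟨h0, h1, h2, h3, h4, h5, h6, h7⟩ := hullFamily_apply ω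
  rw [sum_zmod_eight, h0, h1, h2, h3, h4, h5, h6, h7]
  simp [finrank_line]

theorem not_cyclicShift_one_mem [CharP F 3] (hω : orderOf ω = 8) :
    ¬ ∀ c ∈ spectralCode ω (codeFamily ω), cyclicShift 1 c ∈ spectralCode ω (codeFamily ω) := by
  intro h
  have hw : (![1, ω ^ 6] : Fin 2 → F) ∈ codeFamily ω 7 := mem_line.2 (by simp)
  have h1 := mem_spectralCode.1 (h _ (spectralWord_mem_spectralCode hω hw)) 7
  rw [evalAt_cyclicShift_one _ (root_pow_eight hω 7), evalAt_spectralWord hω, if_pos rfl] at h1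
  have h2 := mem_line.1 h1
  have h8 : ω ^ 8 = 1 := hω ▸ pow_orderOf_eq_one ω
  have h4 := pow_four_eq hω
  simp only [root, Matrix.cons_val_zero, Matrix.cons_val_one, Pi.neg_apply] at h2
  rw [show (7 : ZMod 8).val = 7 from rfl] at h2
  -- the shift maps `(1, ω ^ 6)` to a multiple of `(1, ω ^ 3)`
  refine pow_ne_pow hω (a := 0) (b := 3) (by norm_num) (by norm_num) (by norm_num) ?_
  linear_combination -h2 + (ω ^ 11 + ω ^ 3) * h8

theorem isQutritExampleCode_iff [CharP F 3] (hω : orderOf ω = 8)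
    {D : Submodule F (Fin (8 * 2) → F)} :
    IsQutritExampleCode ω D ↔ D = spectralCode ω (codeFamily ω) := by
  have h4 := pow_four_eq hω
  have r0 : root ω 0 = 1 := pow_zero ω
  have r1 : root ω 1 = ω := pow_one ω
  have r4 : root ω 4 = -1 := h4
  constructor
  · rintro ⟨⟨⟨-, hshift⟩, -⟩, c4, c0, c5, c3, c6, c2, c7, c1⟩
    rw [eq_spectralCode_constituent hω hshift]
    congr 1
    funext j
    revert j
    refine forall_zmod_eight ?_ ?_ c2 c3 ?_ c5 c6 c7
    · rw [r0]; exact c0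
    · rw [r1]; exact c1
    · rw [r4]; exact c4
  · rintro rfl
    have hc := constituent_spectralCode hω (codeFamily ω)
    refine ⟨⟨⟨two_pos, fun c hc => cyclicShift_two_mem_spectralCode hω hc⟩, ?_⟩, ?_, ?_, hc 5, hc 3,
      hc 6, hc 2, hc 7, ?_⟩
    · rintro s ⟨hs, hinv⟩
      by_contra! hlt
      obtain rfl : s = 1 := by omega
      exact not_cyclicShift_one_mem hω hinv
    · rw [← r4]; exact hc 4
    · rw [← r0]; exact hc 0
    · have h1 := hc 1
      rw [r1] at h1
      exact h1

/-- The word whose columns list the coefficients of the polynomials `f 0` and `f 1`. -/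
def polyWord (f : Fin 2 → F[X]) : Fin (8 * 2) → F := fun i =>
  (f (finProdFinEquiv.symm i).2).coeff ((finProdFinEquiv.symm i).1 : ℕ)

theorem arrayEntry_polyWord (f : Fin 2 → F[X]) (g : Fin 8) (t : Fin 2) :
    arrayEntry (polyWord f) g t = (f t).coeff g := by
  simp only [arrayEntry, polyWord, Equiv.symm_apply_apply]

theorem columnPoly_polyWord {f : Fin 2 → F[X]} {t : Fin 2} (hf : (f t).natDegree < 8) :
    columnPoly (m := 8) (l := 2) (polyWord f) t = f t := by
  simp only [columnPoly, arrayEntry_polyWord]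
  rw [Fin.sum_univ_eq_sum_range (fun g => C ((f t).coeff g) * X ^ g)]
  exact (as_sum_range_C_mul_X_pow' (f t) hf).symm

theorem evalAt_polyWord {f : Fin 2 → F[X]} (hf : ∀ t, (f t).natDegree < 8) (a : F) :
    evalAt 8 2 a (polyWord f) = fun t => (f t).eval a :=
  funext fun t => congrArg (eval a) (columnPoly_polyWord (hf t))

/-- The word with the coefficients of `f` in the first column, and zeros in the second one. -/
noncomputable def firstColumnWord (f : F[X]) : Fin (8 * 2) → F := polyWord ![f, 0]

theorem evalAt_firstColumnWord {f : F[X]} (hf : f.natDegree < 8) (a : F) :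
    evalAt 8 2 a (firstColumnWord f) = ![f.eval a, 0] := by
  rw [firstColumnWord, evalAt_polyWord]
  · funext t
    fin_cases t <;> simp
  · intro t
    fin_cases t <;> simp [hf]

theorem hammingNorm_firstColumnWord_le [DecidableEq F] (f : F[X]) :
    hammingNorm (firstColumnWord f) ≤ f.natDegree + 1 := by
  rw [hammingNorm_eq_add]
  have h1 : column (firstColumnWord f) 1 = 0 := by
    funext g
    exact arrayEntry_polyWord _ _ _
  rw [h1, hammingNorm_zero, add_zero, ← Finset.card_range (f.natDegree + 1)]
  refine Finset.card_le_card_of_injOn (fun g : Fin 8 => (g : ℕ)) (fun g hg => ?_)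
    Fin.val_injective.injOn
  rw [Finset.mem_coe, Finset.mem_filter] at hg
  have h2 : f.coeff g ≠ 0 := by
    have := hg.2
    rwa [column, firstColumnWord, arrayEntry_polyWord] at this
  have := le_natDegree_of_ne_zero h2
  rw [Finset.mem_coe, Finset.mem_range]
  exact Nat.lt_succ_of_le this

/-- The polynomial `(x - ω) ⋯ (x - ω ^ m)`. -/
noncomputable def bchPoly (ω : F) (m : ℕ) : F[X] := ∏ r ∈ Finset.Icc 1 m, (X - C (ω ^ r))

theorem natDegree_bchPoly (ω : F) (m : ℕ) : (bchPoly ω m).natDegree = m := by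
  rw [bchPoly, natDegree_prod_of_monic _ _ fun r _ => monic_X_sub_C _]
  simp only [natDegree_X_sub_C, Finset.sum_const, Nat.card_Icc, smul_eq_mul, mul_one,
    Nat.add_sub_cancel]

theorem eval_bchPoly_eq_zero {m r : ℕ} (h1 : 1 ≤ r) (hr : r ≤ m) :
    (bchPoly ω m).eval (ω ^ r) = 0 := by
  rw [bchPoly, eval_prod]
  exact Finset.prod_eq_zero (Finset.mem_Icc.2 ⟨h1, hr⟩) (by simp)

theorem eval_one_bchPoly_ne_zero (hω : orderOf ω = 8) {m : ℕ} (hm : m < 8) :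
    (bchPoly ω m).eval 1 ≠ 0 := by
  rw [bchPoly, eval_prod, Finset.prod_ne_zero_iff]
  intro r hr
  rw [Finset.mem_Icc] at hr
  rw [eval_sub, eval_X, eval_C, sub_ne_zero, ← pow_zero ω]
  exact pow_ne_pow hω (by norm_num) (by omega) (by omega)

theorem bchWord_ne_zero (hω : orderOf ω = 8) {m : ℕ} (hm : m < 8) :
    evalAt 8 2 1 (firstColumnWord (bchPoly ω m)) ≠ 0 := by
  rw [evalAt_firstColumnWord (by rwa [natDegree_bchPoly])]
  exact fun h => eval_one_bchPoly_ne_zero hω hm (congrFun h 0)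

theorem evalAt_bchWord {m r : ℕ} (hm : m < 8) (h1 : 1 ≤ r) (hr : r ≤ m) :
    evalAt 8 2 (ω ^ r) (firstColumnWord (bchPoly ω m)) = 0 := by
  rw [evalAt_firstColumnWord (by rwa [natDegree_bchPoly]), eval_bchPoly_eq_zero h1 hr]
  funext t; fin_cases t <;> rfl

theorem bchWord_notMem (hω : orderOf ω = 8) {m : ℕ} (hm : m < 8)
    {K : ZMod 8 → Submodule F (Fin 2 → F)} (hK : K 0 = ⊥) :
    firstColumnWord (bchPoly ω m) ∉ spectralCode ω K := by
  intro h
  have h0 := mem_spectralCode.1 h 0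
  rw [hK, Submodule.mem_bot, root_zero] at h0
  exact bchWord_ne_zero hω hm h0

/-- The word of `(x - ω) ⋯ (x - ω ^ 4)`, which will turn out to have weight five. -/
theorem bchWord_mem_dual : firstColumnWord (bchPoly ω 4) ∈ spectralCode ω (dualFamily ω) := by
  have h : ∀ j : ZMod 8, 1 ≤ j.val → j.val ≤ 4 →
      evalAt 8 2 (root ω j) (firstColumnWord (bchPoly ω 4)) ∈ dualFamily ω j := fun j h1 h4 => by
    rw [root, evalAt_bchWord (by norm_num) h1 h4]
    exact Submodule.zero_mem _
  exact mem_spectralCode.2 (forall_zmod_eight trivial (h 1 (by decide) (by decide))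
    (h 2 (by decide) (by decide)) (h 3 (by decide) (by decide)) (h 4 (by decide) (by decide))
    trivial trivial trivial)

/-- The word of `(x - ω) (x - ω ^ 2) (x - ω ^ 3)`, which will turn out to have weight four. -/
theorem bchWord_mem_sum : firstColumnWord (bchPoly ω 3) ∈ spectralCode ω (sumFamily ω) := by
  have h : ∀ j : ZMod 8, 1 ≤ j.val → j.val ≤ 3 →
      evalAt 8 2 (root ω j) (firstColumnWord (bchPoly ω 3)) ∈ sumFamily ω j := fun j h1 h4 => by
    rw [root, evalAt_bchWord (by norm_num) h1 h4]
    exact Submodule.zero_mem _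
  exact mem_spectralCode.2 (forall_zmod_eight trivial (h 1 (by decide) (by decide))
    (h 2 (by decide) (by decide)) (h 3 (by decide) (by decide)) trivial
    trivial trivial trivial)

theorem firstColumnWord_bchPoly_ne_zero (hω : orderOf ω = 8) {m : ℕ} (hm : m < 8) :
    firstColumnWord (bchPoly ω m) ≠ 0 := fun h =>
  bchWord_ne_zero hω hm (by rw [h, map_zero])

variable [Fintype F] [DecidableEq F] [CharP F 3]

theorem four_le_hammingNorm (hF : Fintype.card F = 9) (hω : orderOf ω = 8) {c : Fin (8 * 2) → F}
    (hc : c ∈ spectralCode ω (sumFamily ω)) (hc0 : c ≠ 0) : 4 ≤ hammingNorm c := by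
  have h := mem_spectralCode.1 hc
  have h1 := h 1
  rw [show root ω 1 = ω from pow_one ω] at h1
  exact (le_hammingNorm hF hω hc0 h1 (h 2) (h 3)).1

theorem five_le_hammingNorm (hF : Fintype.card F = 9) (hω : orderOf ω = 8) {c : Fin (8 * 2) → F}
    (hc : c ∈ spectralCode ω (dualFamily ω)) (hc0 : c ≠ 0) : 5 ≤ hammingNorm c := by
  have h := mem_spectralCode.1 hc
  have h1 := h 1
  rw [show root ω 1 = ω from pow_one ω] at h1
  exact (le_hammingNorm hF hω hc0 h1 (h 2) (h 3)).2 (h 4)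

theorem hammingNorm_bchWord_four (hF : Fintype.card F = 9) (hω : orderOf ω = 8) :
    hammingNorm (firstColumnWord (bchPoly ω 4)) = 5 := by
  have h := hammingNorm_firstColumnWord_le (bchPoly ω 4)
  rw [natDegree_bchPoly] at h
  exact le_antisymm h (five_le_hammingNorm hF hω bchWord_mem_dual
    (firstColumnWord_bchPoly_ne_zero hω (by norm_num)))

theorem hammingNorm_bchWord_three (hF : Fintype.card F = 9) (hω : orderOf ω = 8) :
    hammingNorm (firstColumnWord (bchPoly ω 3)) = 4 := by
  have h := hammingNorm_firstColumnWord_le (bchPoly ω 3)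
  rw [natDegree_bchPoly] at h
  exact le_antisymm h (four_le_hammingNorm hF hω bchWord_mem_sum
    (firstColumnWord_bchPoly_ne_zero hω (by norm_num)))

theorem isMinDist_dual (hF : Fintype.card F = 9) (hω : orderOf ω = 8) :
    IsMinDist (spectralCode ω (dualFamily ω)) 5 := by
  refine ⟨⟨_, bchWord_mem_dual, firstColumnWord_bchPoly_ne_zero hω (by norm_num),
    hammingNorm_bchWord_four hF hω⟩, ?_⟩
  rintro _ ⟨c, hc, hc0, rfl⟩
  exact five_le_hammingNorm hF hω hc hc0

theorem isMinDist_sum (hF : Fintype.card F = 9) (hω : orderOf ω = 8) :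
    IsMinDist (spectralCode ω (sumFamily ω)) 4 := by
  refine ⟨⟨_, bchWord_mem_sum, firstColumnWord_bchPoly_ne_zero hω (by norm_num),
    hammingNorm_bchWord_three hF hω⟩, ?_⟩
  rintro _ ⟨c, hc, hc0, rfl⟩
  exact four_le_hammingNorm hF hω hc hc0

end QutritExample

/-! ### The extended code of length `17` -/

section ExtendedCode

variable {F : Type*} [Field F] {ω : F}

/-- The linear map forgetting the last entry of a word. -/
def dropLast (F : Type*) [Field F] (n : ℕ) : (Fin (n + 1) → F) →ₗ[F] (Fin n → F) :=
  LinearMap.funLeft F F Fin.castSucc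

theorem dropLast_snoc {n : ℕ} (c : Fin n → F) (a : F) : dropLast F n (Fin.snoc c a) = c := by
  funext i
  simp [dropLast, LinearMap.funLeft_apply]

/-- The quasi-cyclic code of length `16`, extended by one entry that depends linearly on the
evaluation at `ω ^ 4 = -1`, so that the extended code is Hermitian self-orthogonal: the code fails
to be so only at this frequency, and `ω` has norm `ω ^ 4 = -1`. -/
noncomputable def extendedCode (ω : F) : Submodule F (Fin (8 * 2 + 1) → F) :=
  (spectralCode ω (codeFamily ω)).comap (dropLast F (8 * 2)) ⊓
    LinearMap.ker ((LinearMap.proj (Fin.last (8 * 2)) : (Fin (8 * 2 + 1) → F) →ₗ[F] F) +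
      ω • ((LinearMap.proj 0).comp (evalAt 8 2 (root ω 4))).comp (dropLast F (8 * 2)))

theorem mem_extendedCode {u : Fin (8 * 2 + 1) → F} :
    u ∈ extendedCode ω ↔ dropLast F (8 * 2) u ∈ spectralCode ω (codeFamily ω) ∧
      u (Fin.last (8 * 2)) = -(ω * evalAt 8 2 (root ω 4) (dropLast F (8 * 2) u) 0) := by
  rw [extendedCode, Submodule.mem_inf, Submodule.mem_comap, LinearMap.mem_ker,
    eq_neg_iff_add_eq_zero]
  rfl

theorem snoc_mem_extendedCode {c : Fin (8 * 2) → F} (hc : c ∈ spectralCode ω (codeFamily ω)) :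
    (Fin.snoc c (-(ω * evalAt 8 2 (root ω 4) c 0)) : Fin (8 * 2 + 1) → F) ∈ extendedCode ω := by
  rw [mem_extendedCode, dropLast_snoc, Fin.snoc_last]
  exact ⟨hc, rfl⟩

theorem sum_mul_pow_three_succ {n : ℕ} (u v : Fin (n + 1) → F) :
    ∑ i, u i * v i ^ 3 = ∑ i, dropLast F n u i * dropLast F n v i ^ 3 +
      u (Fin.last n) * v (Fin.last n) ^ 3 := Fin.sum_univ_castSucc _

section

variable [CharP F 3]

theorem finrank_extendedCode (hω : orderOf ω = 8) :
    Module.finrank F (extendedCode ω) = 5 := by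
  rw [← finrank_codeFamily ω, ← finrank_spectralCode hω]
  let f : extendedCode ω →ₗ[F] spectralCode ω (codeFamily ω) :=
    ((dropLast F (8 * 2)).comp (extendedCode ω).subtype).codRestrict _
      fun u => (mem_extendedCode.1 u.2).1
  refine (LinearEquiv.ofBijective f ⟨?_, fun c => ?_⟩).finrank_eq
  · intro u v huv
    have h : dropLast F (8 * 2) (u : Fin (8 * 2 + 1) → F) = dropLast F (8 * 2) v :=
      congrArg Subtype.val huv
    refine Subtype.ext (funext fun i => ?_)
    induction i using Fin.lastCases with
    | last => rw [(mem_extendedCode.1 u.2).2, (mem_extendedCode.1 v.2).2, h]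
    | cast i => exact congrFun h i
  · exact ⟨⟨_, snoc_mem_extendedCode c.2⟩, Subtype.ext (dropLast_snoc _ _)⟩

/-- The conditions on a word in the Hermitian dual of the extended code: at the frequencies other
than `-1` they are those of the dual code, and the last entry is the defect of the condition at `-1`.
-/
theorem of_mem_hermitianDual_extendedCode (hω : orderOf ω = 8) {u : Fin (8 * 2 + 1) → F}
    (hu : u ∈ hermitianDual 3 (extendedCode ω)) :
    (∀ j : ZMod 8, j ≠ 4 → evalAt 8 2 (root ω j) (dropLast F (8 * 2) u) ∈ dualFamily ω j) ∧
      evalAt 8 2 (root ω 4) (dropLast F (8 * 2) u) 0 +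
        ω ^ 6 * evalAt 8 2 (root ω 4) (dropLast F (8 * 2) u) 1 +
          ω ^ 3 * u (Fin.last (8 * 2)) = 0 := by
  have key : ∀ (j : ZMod 8) (w : Fin 2 → F), w ∈ codeFamily ω j →
      ∑ t, evalAt 8 2 (root ω (-3 * j)) (dropLast F (8 * 2) u) t * w t ^ 3 +
        u (Fin.last (8 * 2)) * (-(ω * (if 4 = j then -w else 0 : Fin 2 → F) 0)) ^ 3 = 0 := by
    intro j w hw
    have h := hu _ (snoc_mem_extendedCode (spectralWord_mem_spectralCode hω hw))
    rwa [sum_mul_pow_three_succ, dropLast_snoc, Fin.snoc_last, evalAt_spectralWord hω,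
      sum_mul_spectralWord_pow_three hω] at h
  constructor
  · intro i hi
    rw [← hermitianDual_codeFamily hω]
    intro w hw
    have h := key _ w hw
    have h9 : ∀ j : ZMod 8, -3 * (-3 * j) = j := by decide
    have h4 : ∀ j : ZMod 8, j ≠ 4 → 4 ≠ -3 * j := by decide
    rw [if_neg (h4 i hi), h9] at h
    simpa using h
  · have h := key 4 ![1, ω ^ 2] (mem_line.2 (by simp))
    rw [show (-3 * 4 : ZMod 8) = 4 by decide, if_pos rfl, Fin.sum_univ_two] at h
    simp only [Matrix.cons_val_zero, Matrix.cons_val_one, Pi.neg_apply] at h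
    linear_combination h

theorem extendedCode_le_hermitianDual (hω : orderOf ω = 8) :
    extendedCode ω ≤ hermitianDual 3 (extendedCode ω) := by
  have h4 := pow_four_eq hω
  have h3 : (3 : F) = 0 := by exact_mod_cast CharP.cast_eq_zero F 3
  intro u hu v hv
  obtain ⟨hu, hul⟩ := mem_extendedCode.1 hu
  obtain ⟨hv, hvl⟩ := mem_extendedCode.1 hv
  rw [sum_mul_pow_three_succ, sum_mul_pow_three hω, hul, hvl, Finset.sum_eq_single 4]
  · have hu4 := mem_line.1 (mem_spectralCode.1 hu 4)
    have hv4 := mem_line.1 (mem_spectralCode.1 hv 4)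
    rw [show (-3 * 4 : ZMod 8) = 4 by decide, Fin.sum_univ_two, hu4, hv4]
    generalize evalAt 8 2 (root ω 4) (dropLast F (8 * 2) u) 0 = x
    generalize evalAt 8 2 (root ω 4) (dropLast F (8 * 2) v) 0 = y
    linear_combination x * y ^ 3 * (2 - ω ^ 4) * h4 - x * y ^ 3 * h3
  · intro j _ hj
    have hle : ∀ i : ZMod 8, i ≠ 4 → codeFamily ω i ≤ hermitianDual 3 (codeFamily ω (-3 * i)) := by
      intro i hi
      rw [show hermitianDual 3 (codeFamily ω (-3 * i)) = dualFamily ω i from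
        congrFun (hermitianDual_codeFamily hω) i]
      revert hi
      revert i
      refine forall_zmod_eight ?_ ?_ ?_ ?_ (fun h => absurd rfl h) ?_ ?_ ?_ <;> intro _ <;>
        simp only [codeFamily_apply, dualFamily_apply, bot_le, le_top, le_refl]
    have h9 : ∀ j : ZMod 8, -3 * (-3 * j) = j := by decide
    have h4 : ∀ j : ZMod 8, j ≠ 4 → -3 * j ≠ 4 := by decide
    have h := hle _ (h4 j hj) (mem_spectralCode.1 hu (-3 * j))
    rw [h9] at h
    exact h _ (mem_spectralCode.1 hv j)
  · simp

end

theorem pow_three_ne_self (hω : orderOf ω = 8) : ω ^ 3 ≠ ω := by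
  conv_rhs => rw [← pow_one ω]
  exact pow_ne_pow hω (by norm_num) (by norm_num) (by norm_num)

theorem hammingNorm_succ [DecidableEq F] {n : ℕ} (u : Fin (n + 1) → F) :
    hammingNorm u = hammingNorm (dropLast F n u) + if u (Fin.last n) ≠ 0 then 1 else 0 := by
  simp only [hammingNorm, Finset.card_filter]
  exact Fin.sum_univ_castSucc _

variable [CharP F 3]

theorem five_le_hammingNorm_extended [Fintype F] [DecidableEq F]
    (hF : Fintype.card F = 9) (hω : orderOf ω = 8)
    {u : Fin (8 * 2 + 1) → F} (hu : u ∈ hermitianDual 3 (extendedCode ω)) (hu0 : u ≠ 0) :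
    5 ≤ hammingNorm u := by
  have hω0 : ω ≠ 0 := by
    rintro rfl
    simp [orderOf_zero] at hω
  have h4 := pow_four_eq hω
  obtain ⟨h, hlast⟩ := of_mem_hermitianDual_extendedCode hω hu
  have hv0 : dropLast F (8 * 2) u ≠ 0 := by
    intro hv0
    rw [hv0] at hlast
    simp only [map_zero, Pi.zero_apply, mul_zero, zero_add, mul_eq_zero, pow_eq_zero_iff,
      three_ne_zero, ne_eq, not_false_eq_true, hω0, false_or] at hlast
    apply hu0
    funext i
    induction i using Fin.lastCases with
    | last => exact hlast
    | cast i => exact congrFun hv0 i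
  have h1 := h 1 (by decide)
  rw [show root ω 1 = ω from pow_one ω] at h1
  have hw := le_hammingNorm hF hω hv0 h1 (h 2 (by decide)) (h 3 (by decide))
  rw [hammingNorm_succ]
  split_ifs with hl
  · exact Nat.succ_le_succ hw.1
  · refine hw.2 (mem_line.2 ?_)
    rw [not_not] at hl
    rw [hl, mul_zero, add_zero] at hlast
    change evalAt 8 2 (root ω 4) (dropLast F (8 * 2) u) 1 =
      ω ^ 6 * evalAt 8 2 (root ω 4) (dropLast F (8 * 2) u) 0
    linear_combination (-ω ^ 6) * hlast +
      (ω ^ 8 - ω ^ 4 + 1) * evalAt 8 2 (root ω 4) (dropLast F (8 * 2) u) 1 * h4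

theorem snoc_zero_mem_hermitianDual (hω : orderOf ω = 8) {c : Fin (8 * 2) → F}
    (hc : c ∈ spectralCode ω (dualFamily ω)) :
    (Fin.snoc c 0 : Fin (8 * 2 + 1) → F) ∈ hermitianDual 3 (extendedCode ω) := by
  rw [← hermitianDual_codeFamily hω, ← hermitianDual_spectralCode hω] at hc
  intro v hv
  rw [sum_mul_pow_three_succ, dropLast_snoc, Fin.snoc_last, zero_mul, add_zero]
  exact hc _ (mem_extendedCode.1 hv).1

variable [Fintype F] [DecidableEq F]

theorem exists_isSymplecticCode_17_7_5 (hF : Fintype.card F = 9) (hω : orderOf ω = 8) :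
    ∃ L, IsSymplecticCode 3 17 7 5 L := by
  refine exists_isSymplecticCode_of_hermitian (n := 8 * 2 + 1) hF (pow_three_ne_self hω)
    (extendedCode_le_hermitianDual hω) (by rw [finrank_extendedCode hω])
    (fun v hv hv0 => five_le_hammingNorm_extended hF hω hv hv0)
    ⟨Fin.snoc (firstColumnWord (bchPoly ω 4)) 0, snoc_zero_mem_hermitianDual hω bchWord_mem_dual,
      fun h => ?_, ?_⟩
  · have h1 := (mem_extendedCode.1 h).1
    rw [dropLast_snoc] at h1
    exact bchWord_notMem hω (by norm_num) rfl h1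
  · rw [hammingNorm_succ, dropLast_snoc, Fin.snoc_last, hammingNorm_bchWord_four hF hω]
    simp

theorem exists_isSymplecticCode_16_8_4 (hF : Fintype.card F = 9) (hω : orderOf ω = 8) :
    ∃ L, IsSymplecticCode 3 16 8 4 L := by
  have hdual : hermitianDual 3 (spectralCode ω (hullFamily ω)) = spectralCode ω (sumFamily ω) := by
    rw [hermitianDual_spectralCode hω, hermitianDual_hullFamily hω]
  refine exists_isSymplecticCode_of_hermitian (n := 8 * 2) (E := spectralCode ω (hullFamily ω)) hF
    (pow_three_ne_self hω) ?_ (by rw [finrank_spectralCode hω, finrank_hullFamily]) ?_ ?_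
  · rw [hdual, ← codeFamily_inf_dualFamily hω, ← codeFamily_sup_dualFamily hω]
    intro c hc
    exact mem_spectralCode.2 fun j => Submodule.mem_sup_left (mem_spectralCode.1 hc j).1
  · rw [hdual]
    exact fun v hv hv0 => four_le_hammingNorm hF hω hv hv0
  · rw [hdual]
    exact ⟨_, bchWord_mem_sum, bchWord_notMem hω (by norm_num) rfl,
      hammingNorm_bchWord_three hF hω⟩

end ExtendedCode

/-! ### Generators of the code over `F[x] / (x ^ 8 - 1)` -/

section Generators

variable {F : Type*} [Field F] {ω : F}

theorem toPolyVector_apply {m l : ℕ} (c : Fin (m * l) → F) (t : Fin l) :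
    toPolyVector c t = ∑ g : Fin m, AdjoinRoot.of (X ^ m - 1 : F[X]) (arrayEntry c g t) *
      AdjoinRoot.root (X ^ m - 1 : F[X]) ^ (g : ℕ) := by
  simp [toPolyVector, columnPoly]

theorem toPolyVector_add {m l : ℕ} (c d : Fin (m * l) → F) :
    toPolyVector (c + d) = toPolyVector c + toPolyVector d := by
  funext t
  simp only [Pi.add_apply, toPolyVector_apply, ← Finset.sum_add_distrib, ← add_mul, ← map_add]
  rfl

theorem toPolyVector_smul {m l : ℕ} (a : F) (c : Fin (m * l) → F) :
    toPolyVector (a • c) = AdjoinRoot.of (X ^ m - 1 : F[X]) a • toPolyVector c := by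
  funext t
  simp only [Pi.smul_apply, smul_eq_mul, toPolyVector_apply, Finset.mul_sum, ← mul_assoc, ← map_mul]
  rfl

theorem toPolyVector_cyclicShift_two (c : Fin (8 * 2) → F) :
    toPolyVector (cyclicShift 2 c) = AdjoinRoot.root (X ^ 8 - 1 : F[X]) • toPolyVector c := by
  have h8 : AdjoinRoot.root (X ^ 8 - 1 : F[X]) ^ 8 = 1 := by
    have h := AdjoinRoot.mk_self (f := (X ^ 8 - 1 : F[X]))
    rw [map_sub, map_pow, AdjoinRoot.mk_X, map_one] at h
    exact sub_eq_zero.1 h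
  funext t
  simp only [Pi.smul_apply, smul_eq_mul, toPolyVector_apply, arrayEntry_cyclicShift_two]
  exact sum_sub_one_mul_pow
    (fun g => AdjoinRoot.of (X ^ 8 - 1 : F[X]) (arrayEntry c g t)) h8

/-- A code that is invariant under the shift by two positions corresponds to a submodule over
`F[x] / (x ^ 8 - 1)`. -/
theorem smul_mem_image_toPolyVector {D : Submodule F (Fin (8 * 2) → F)}
    (hD : ∀ c ∈ D, cyclicShift 2 c ∈ D) (r : AdjoinRoot (X ^ 8 - 1 : F[X]))
    {y : Fin 2 → AdjoinRoot (X ^ 8 - 1 : F[X])} (hy : y ∈ toPolyVector '' (D : Set _)) :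
    r • y ∈ toPolyVector '' (D : Set (Fin (8 * 2) → F)) := by
  have hadd : ∀ {y z : Fin 2 → AdjoinRoot (X ^ 8 - 1 : F[X])},
      y ∈ toPolyVector '' (D : Set (Fin (8 * 2) → F)) → z ∈ toPolyVector '' (D : Set _) →
      y + z ∈ toPolyVector '' (D : Set (Fin (8 * 2) → F)) := by
    rintro _ _ ⟨c, hc, rfl⟩ ⟨d, hd, rfl⟩
    exact ⟨c + d, D.add_mem hc hd, toPolyVector_add c d⟩
  obtain ⟨f, rfl⟩ := AdjoinRoot.mk_surjective r
  induction f using Polynomial.induction_on' generalizing y with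
  | add f g hf hg =>
    rw [map_add, add_smul]
    exact hadd (hf hy) (hg hy)
  | monomial n a =>
    induction n generalizing y with
    | zero =>
      obtain ⟨c, hc, rfl⟩ := hy
      refine ⟨a • c, D.smul_mem a hc, ?_⟩
      rw [toPolyVector_smul]
      rfl
    | succ n ih =>
      obtain ⟨c, hc, rfl⟩ := hy
      rw [← monomial_mul_X, map_mul, mul_smul, AdjoinRoot.mk_X, ← toPolyVector_cyclicShift_two]
      exact ih ⟨_, hD c hc, rfl⟩

theorem natDegree_qutritGen1_lt (ω : F) (t : Fin 2) : (qutritGen1 ω t).natDegree < 8 := by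
  fin_cases t
  · simp only [qutritGen1, Fin.zero_eta, Matrix.cons_val_zero]
    rw [Nat.lt_succ_iff]
    compute_degree!
  · simp only [qutritGen1, Fin.mk_one, Matrix.cons_val_one, Matrix.cons_val_fin_one]
    rw [Nat.lt_succ_iff]
    compute_degree!

theorem natDegree_qutritGen2_lt (ω : F) (t : Fin 2) : (qutritGen2 ω t).natDegree < 8 := by
  fin_cases t
  · simp [qutritGen2]
  · simp only [qutritGen2, Fin.mk_one, Matrix.cons_val_one, Matrix.cons_val_fin_one]
    rw [Nat.lt_succ_iff]
    compute_degree!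

/-- The values of the first generator at the eighth roots of unity. -/
theorem eval_qutritGen1 (h3 : (3 : F) = 0) (h : ω ^ 2 = ω + 1) : ∀ j : ZMod 8,
    (fun t => (qutritGen1 ω t).eval (root ω j)) = (![0, 0, ![1, ω ^ 7], 0, ![1, ω ^ 2], ![1, 0], 0,
      ![1, ω ^ 6]] : ZMod 8 → Fin 2 → F) j := by
  intro j
  funext t
  refine forall_zmod_eight (P := fun j => (qutritGen1 ω t).eval (root ω j) = (![0, 0, ![1, ω ^ 7],
    0, ![1, ω ^ 2], ![1, 0], 0, ![1, ω ^ 6]] : ZMod 8 → Fin 2 → F) j t) ?_ ?_ ?_ ?_ ?_ ?_ ?_ ?_ j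
  · change (qutritGen1 ω t).eval (ω ^ 0) = 0
    fin_cases t <;> simp [qutritGen1] <;> grind
  · change (qutritGen1 ω t).eval (ω ^ 1) = 0
    fin_cases t <;> simp [qutritGen1] <;> grind
  · change (qutritGen1 ω t).eval (ω ^ 2) = (![1, ω ^ 7] : Fin 2 → F) t
    fin_cases t <;> simp [qutritGen1] <;> grind
  · change (qutritGen1 ω t).eval (ω ^ 3) = 0
    fin_cases t <;> simp [qutritGen1] <;> grind
  · change (qutritGen1 ω t).eval (ω ^ 4) = (![1, ω ^ 2] : Fin 2 → F) t
    fin_cases t <;> simp [qutritGen1] <;> grind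
  · change (qutritGen1 ω t).eval (ω ^ 5) = (![1, 0] : Fin 2 → F) t
    fin_cases t <;> simp [qutritGen1] <;> grind
  · change (qutritGen1 ω t).eval (ω ^ 6) = 0
    fin_cases t <;> simp [qutritGen1] <;> grind
  · change (qutritGen1 ω t).eval (ω ^ 7) = (![1, ω ^ 6] : Fin 2 → F) t
    fin_cases t <;> simp [qutritGen1] <;> grind

/-- The values of the second generator at the eighth roots of unity. -/
theorem eval_qutritGen2 (h3 : (3 : F) = 0) (h : ω ^ 2 = ω + 1) : ∀ j : ZMod 8,
    (fun t => (qutritGen2 ω t).eval (root ω j)) = if j = 5 then ![0, 1] else 0 := by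
  intro j
  funext t
  revert j
  fin_cases t
  · intro j
    split_ifs <;> simp [qutritGen2]
  · apply forall_zmod_eight
    · change (qutritGen2 ω 1).eval (ω ^ 0) = 0
      simp [qutritGen2]; grind
    · change (qutritGen2 ω 1).eval (ω ^ 1) = 0
      simp [qutritGen2]; grind
    · change (qutritGen2 ω 1).eval (ω ^ 2) = 0
      simp [qutritGen2]; grind
    · change (qutritGen2 ω 1).eval (ω ^ 3) = 0
      simp [qutritGen2]; grind
    · change (qutritGen2 ω 1).eval (ω ^ 4) = 0
      simp [qutritGen2]; grind
    · change (qutritGen2 ω 1).eval (ω ^ 5) = 1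
      simp [qutritGen2]; grind
    · change (qutritGen2 ω 1).eval (ω ^ 6) = 0
      simp [qutritGen2]; grind
    · change (qutritGen2 ω 1).eval (ω ^ 7) = 0
      simp [qutritGen2]; grind

theorem toPolyVector_polyWord {f : Fin 2 → F[X]} (hf : ∀ t, (f t).natDegree < 8) :
    toPolyVector (polyWord f) = reducePolyVector 8 f :=
  funext fun t => congrArg (AdjoinRoot.mk (X ^ 8 - 1 : F[X])) (columnPoly_polyWord (hf t))

theorem polyWord_qutritGen_mem (h3 : (3 : F) = 0) (h : ω ^ 2 = ω + 1) :
    polyWord (qutritGen1 ω) ∈ spectralCode ω (codeFamily ω) ∧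
      polyWord (qutritGen2 ω) ∈ spectralCode ω (codeFamily ω) := by
  constructor
  · rw [mem_spectralCode]
    intro j
    rw [evalAt_polyWord (natDegree_qutritGen1_lt ω), eval_qutritGen1 h3 h]
    revert j
    exact forall_zmod_eight (Submodule.zero_mem _) (Submodule.zero_mem _)
      (Submodule.mem_span_singleton_self _) (Submodule.zero_mem _)
      (Submodule.mem_span_singleton_self _) trivial (Submodule.zero_mem _)
      (Submodule.mem_span_singleton_self _)
  · rw [mem_spectralCode]
    intro j
    rw [evalAt_polyWord (natDegree_qutritGen2_lt ω), eval_qutritGen2 h3 h]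
    split_ifs with hj
    · subst hj; trivial
    · exact Submodule.zero_mem _

/-- A shift-invariant code that contains both generators contains the whole code, since the values
of the generators span the constituents. -/
theorem spectralCode_codeFamily_le [CharP F 3] (hω : orderOf ω = 8) (h : ω ^ 2 = ω + 1)
    {M : Submodule F (Fin (8 * 2) → F)} (hM : ∀ c ∈ M, cyclicShift 2 c ∈ M)
    (h1 : polyWord (qutritGen1 ω) ∈ M) (h2 : polyWord (qutritGen2 ω) ∈ M) :
    spectralCode ω (codeFamily ω) ≤ M := by
  have h3 : (3 : F) = 0 := by exact_mod_cast CharP.cast_eq_zero F 3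
  rw [eq_spectralCode_constituent hω hM]
  intro c hc
  rw [mem_spectralCode] at hc ⊢
  intro j
  refine (?_ : codeFamily ω j ≤ constituent 8 2 M (root ω j)) (hc j)
  have e1 : (fun t => (qutritGen1 ω t).eval (root ω j)) ∈ constituent 8 2 M (root ω j) := by
    rw [← evalAt_polyWord (natDegree_qutritGen1_lt ω)]
    exact Submodule.mem_map_of_mem h1
  have e2 : (fun t => (qutritGen2 ω t).eval (root ω j)) ∈ constituent 8 2 M (root ω j) := by
    rw [← evalAt_polyWord (natDegree_qutritGen2_lt ω)]
    exact Submodule.mem_map_of_mem h2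
  rw [eval_qutritGen1 h3 h] at e1
  rw [eval_qutritGen2 h3 h] at e2
  generalize constituent 8 2 M (root ω j) = N at e1 e2 ⊢
  revert e1 e2
  revert j
  refine forall_zmod_eight (fun _ _ => bot_le) (fun _ _ => bot_le)
    (fun e1 _ => (Submodule.span_singleton_le_iff_mem _ _).2 e1) (fun _ _ => bot_le)
    (fun e1 _ => (Submodule.span_singleton_le_iff_mem _ _).2 e1) (fun e1 e2 => ?_)
    (fun _ _ => bot_le) (fun e1 _ => (Submodule.span_singleton_le_iff_mem _ _).2 e1)
  rw [if_pos rfl] at e2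
  intro w _
  have hw : w = w 0 • (![1, 0] : Fin 2 → F) + w 1 • ![0, 1] := by
    funext t
    fin_cases t <;> simp
  rw [hw]
  exact N.add_mem (N.smul_mem _ e1) (N.smul_mem _ e2)

/-- The words that correspond to the elements of a submodule over `F[x] / (x ^ 8 - 1)`. -/
noncomputable def polyPullback
    (N : Submodule (AdjoinRoot (X ^ 8 - 1 : F[X])) (Fin 2 → AdjoinRoot (X ^ 8 - 1 : F[X]))) :
    Submodule F (Fin (8 * 2) → F) where
  carrier := {c | toPolyVector c ∈ N}
  zero_mem' := by
    have h0 := toPolyVector_smul (0 : F) (0 : Fin (8 * 2) → F)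
    rw [zero_smul, map_zero, zero_smul] at h0
    change toPolyVector (0 : Fin (8 * 2) → F) ∈ N
    rw [h0]
    exact N.zero_mem
  add_mem' {c d} hc hd := by
    change toPolyVector (c + d) ∈ N
    rw [toPolyVector_add]
    exact N.add_mem hc hd
  smul_mem' a c hc := by
    change toPolyVector (a • c) ∈ N
    rw [toPolyVector_smul]
    exact N.smul_mem _ hc

theorem mem_polyPullback
    {N : Submodule (AdjoinRoot (X ^ 8 - 1 : F[X])) (Fin 2 → AdjoinRoot (X ^ 8 - 1 : F[X]))}
    {c : Fin (8 * 2) → F} : c ∈ polyPullback N ↔ toPolyVector c ∈ N := Iff.rfl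

theorem image_toPolyVector_eq_span [CharP F 3] (hω : orderOf ω = 8) (h : ω ^ 2 = ω + 1) :
    toPolyVector '' (spectralCode ω (codeFamily ω) : Set (Fin (8 * 2) → F)) =
      (Submodule.span (AdjoinRoot (X ^ 8 - 1 : F[X]))
        {reducePolyVector 8 (qutritGen1 ω), reducePolyVector 8 (qutritGen2 ω)} :
        Set (Fin 2 → AdjoinRoot (X ^ 8 - 1 : F[X]))) := by
  have h3 : (3 : F) = 0 := by exact_mod_cast CharP.cast_eq_zero F 3
  have e1 := toPolyVector_polyWord (natDegree_qutritGen1_lt ω)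
  have e2 := toPolyVector_polyWord (natDegree_qutritGen2_lt ω)
  obtain ⟨m1, m2⟩ := polyWord_qutritGen_mem h3 h
  have hshift : ∀ c ∈ spectralCode ω (codeFamily ω),
      cyclicShift 2 c ∈ spectralCode ω (codeFamily ω) :=
    fun c hc => cyclicShift_two_mem_spectralCode hω hc
  apply Set.Subset.antisymm
  · have hM : spectralCode ω (codeFamily ω) ≤ polyPullback (Submodule.span
        (AdjoinRoot (X ^ 8 - 1 : F[X]))
        {reducePolyVector 8 (qutritGen1 ω), reducePolyVector 8 (qutritGen2 ω)}) := by
      refine spectralCode_codeFamily_le hω h (fun c hc => ?_) ?_ ?_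
      · rw [mem_polyPullback] at hc ⊢
        rw [toPolyVector_cyclicShift_two]
        exact Submodule.smul_mem _ _ hc
      · rw [mem_polyPullback, e1]
        exact Submodule.subset_span (Or.inl rfl)
      · rw [mem_polyPullback, e2]
        exact Submodule.subset_span (Or.inr rfl)
    rintro _ ⟨c, hc, rfl⟩
    exact hM hc
  · intro y hy
    obtain ⟨a, b, rfl⟩ := Submodule.mem_span_pair.1 hy
    obtain ⟨c, hc, hca⟩ := smul_mem_image_toPolyVector hshift a ⟨_, m1, e1⟩
    obtain ⟨d, hd, hdb⟩ := smul_mem_image_toPolyVector hshift b ⟨_, m2, e2⟩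
    exact ⟨c + d, Submodule.add_mem _ hc hd, by rw [toPolyVector_add, hca, hdb]⟩

end Generators

/-! ### The factorization of `x ^ 8 - 1` -/

section Factorization

variable {F : Type*} [Field F] {ω : F}

theorem X_pow_eight_sub_one_eq (hω : orderOf ω = 8) :
    (X ^ 8 - 1 : F[X]) = ∏ j ∈ Finset.range 8, (X + C (ω ^ j)) := by
  have h : (C ω : F[X]) ^ 4 = -1 := by rw [← C_pow, pow_four_eq hω, C_neg, C_1]
  simp only [Finset.prod_range_succ, Finset.prod_range_zero, C_pow]
  generalize (C ω : F[X]) = w at h ⊢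
  rw [show w ^ 5 = -w by linear_combination w * h, show w ^ 6 = -w ^ 2 by
    linear_combination w ^ 2 * h, show w ^ 7 = -w ^ 3 by linear_combination w ^ 3 * h, h]
  linear_combination (X ^ 2 - 1) * (X ^ 2 + 1 + (X ^ 2 - w ^ 2) *
    (X ^ 2 - w ^ 6 + w ^ 2 * (X ^ 2 - w ^ 4) + w ^ 2 * (w ^ 4 + 1))) * h

theorem X_pow_eight_sub_one_eq' (hω : orderOf ω = 8) :
    (X ^ 8 - 1 : F[X]) = (X + 1) * (X - 1) *
      ∏ j ∈ Finset.Icc 1 3, ((X + C (ω ^ j)) * (X + C ((ω ^ j)⁻¹))) := by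
  have h8 : ω ^ 8 = 1 := hω ▸ pow_orderOf_eq_one ω
  have hinv : ∀ i j : ℕ, i + j = 8 → (ω ^ i)⁻¹ = ω ^ j := fun i j hij =>
    inv_eq_of_mul_eq_one_right (by rw [← pow_add, hij, h8])
  rw [X_pow_eight_sub_one_eq hω, show Finset.Icc 1 3 = {1, 2, 3} from rfl]
  simp only [Finset.prod_range_succ, Finset.prod_range_zero]
  rw [Finset.prod_insert (by decide), Finset.prod_insert (by decide), Finset.prod_singleton,
    hinv 1 7 rfl, hinv 2 6 rfl, hinv 3 5 rfl, pow_four_eq hω, pow_zero, C_neg, C_1]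
  ring

end Factorization

/-! ### The code, its parameters, and the quantum codes derived from it -/

theorem mainTheorem2 {F : Type*} [Field F] [Fintype F] [DecidableEq F]
    (hF : Fintype.card F = 9) (ω : F) (hω : orderOf ω = 8) :
    -- the factorization of `x ^ 8 - 1`, with the factors in the order of the constituents
    ((X ^ 8 - 1 : F[X]) = ∏ j ∈ Finset.range 8, (X + C (ω ^ j)) ∧
      (X ^ 8 - 1 : F[X]) = (X + 1) * (X - 1) *
        ∏ j ∈ Finset.Icc 1 3, ((X + C (ω ^ j)) * (X + C ((ω ^ j)⁻¹)))) ∧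
    -- the quasi-cyclic code with the given constituents
    (∃! D : Submodule F (Fin (8 * 2) → F), IsQutritExampleCode ω D) ∧
    (∀ D : Submodule F (Fin (8 * 2) → F), IsQutritExampleCode ω D →
      (ω ^ 2 = ω + 1 →
        toPolyVector '' (D : Set (Fin (8 * 2) → F)) =
          (Submodule.span (AdjoinRoot (X ^ 8 - 1 : F[X]))
            {reducePolyVector 8 (qutritGen1 ω), reducePolyVector 8 (qutritGen2 ω)} :
            Set (Fin 2 → AdjoinRoot (X ^ 8 - 1 : F[X])))) ∧
      Module.finrank F D = 5 ∧
      Module.finrank F (D ⊓ hermitianDual 3 D : Submodule F (Fin (8 * 2) → F)) = 4 ∧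
      Module.finrank F D -
        Module.finrank F (D ⊓ hermitianDual 3 D : Submodule F (Fin (8 * 2) → F)) = 1 ∧
      IsLinearCode 16 11 5 (hermitianDual 3 D) ∧
      IsMinDist (D ⊔ hermitianDual 3 D) 4) ∧
    -- the quantum code and its optimality
    (∃ Q, IsStabilizerCode 3 17 7 5 Q) ∧
    (∀ d Q, IsStabilizerCode 3 17 7 d Q → d ≤ 5) ∧
    -- the codes derived from it by propagation
    (∃ Q, IsStabilizerCode 3 17 6 5 Q) ∧
    (∃ Q, IsStabilizerCode 3 18 7 5 Q) ∧
    (∃ Q, IsStabilizerCode 3 16 7 4 Q) := by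
  have : CharP F 3 := charP_of_card_eq_prime_pow (f := 2) (by rw [hF]; norm_num)
  have hdual : hermitianDual 3 (spectralCode ω (codeFamily ω)) =
      spectralCode ω (dualFamily ω) := by
    rw [hermitianDual_spectralCode hω, hermitianDual_codeFamily hω]
  obtain ⟨L, hL⟩ := exists_isSymplecticCode_17_7_5 hF hω
  obtain ⟨L', hL'⟩ := exists_isSymplecticCode_16_8_4 hF hω
  have h32 : (3 : ℕ) ≠ 2 := by norm_num
  refine ⟨⟨X_pow_eight_sub_one_eq hω, X_pow_eight_sub_one_eq' hω⟩,
    ⟨_, (isQutritExampleCode_iff hω).2 rfl, fun D hD => (isQutritExampleCode_iff hω).1 hD⟩,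
    fun D hD => ?_, ?_, ?_, ?_, ?_, ?_⟩
  · obtain rfl := (isQutritExampleCode_iff hω).1 hD
    rw [hdual, spectralCode_inf, codeFamily_inf_dualFamily hω, spectralCode_sup hω,
      codeFamily_sup_dualFamily hω, finrank_spectralCode hω, finrank_spectralCode hω,
      finrank_codeFamily, finrank_hullFamily]
    refine ⟨image_toPolyVector_eq_span hω, rfl, rfl, rfl, ⟨?_, isMinDist_dual hF hω⟩,
      isMinDist_sum hF hω⟩
    exact (finrank_spectralCode hω _).trans (finrank_dualFamily ω)
  · exact (exists_isStabilizerCode_iff h32).2 ⟨L, hL⟩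
  · intro d Q hQ
    obtain ⟨M, hM⟩ := (exists_isStabilizerCode_iff h32).1 ⟨Q, hQ⟩
    exact hM.distance_le_five
  · exact (exists_isStabilizerCode_iff h32).2 (hL.exists_subcode (by norm_num))
  · exact (exists_isStabilizerCode_iff h32).2 hL.exists_lengthening
  · exact (exists_isStabilizerCode_iff h32).2 (hL'.exists_subcode (by norm_num))
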